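/- Let $V:\mathbb R\to\mathbb R$ be a $C^2$ potential whose weak third derivative satisfies $V^{(3)}\in L^\infty(\mathbb R)$, let $T>0$, $m\in\mathbb N$, and let $B(m,T)$ be a real number. Then there exist constants $B_1=B_1(m,T)$ and $B_2=B_2(m,T)$, depending only on $V$, $T$, $m$ and $B(m,T)$, such that the following holds for every $\varepsilon>0$. Let $q,p,\alpha=\alpha_R+i\alpha_I,B$ solve on $[0,T]$ $$\dot q=p,\quad \dot p=-V'(q),\quad \dot\alpha=-2\alpha^2-\tfrac12V''(q),\quad \dot B=-2B\alpha_R,\qquad \alpha_I(0)>0,\quad B(0)=\sqrt{\alpha_I(0)},$$ put $\tilde\alpha_I=\min_{0\le t\le T}\alpha_I(t)$, and let $Q,P$ solve on $[0,T]$ $$\dot Q=B^2P,\quad \dot P=-4B^2Q,\qquad Q(0)=\tfrac1{\sqrt2},\quad P(0)=i\sqrt2 .$$ Let $$U(\eta,t)=\varepsilon^{-3/2}\Big[V(q+\sqrt\varepsilon B^{-1}\eta)-V(q)-\sqrt\varepsilon\,V'(q)B^{-1}\eta-\tfrac{\varepsilon}{2}V''(q)(B^{-1}\eta)^2\Big],\qquad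 \hat H(t)=-\tfrac12B^2\partial_\eta^2+2B^2\eta^2+\sqrt\varepsilon\,U(\eta,t).$$ Let $\mathcal A(t)=\frac1{\sqrt2}\big(Q(t)\partial_\eta-iP(t)\eta\big)$ and $\mathcal A^\dagger(t)=\frac1{\sqrt2}\big(-\overline{Q(t)}\,\partial_\eta+i\overline{P(t)}\,\eta\big)$ be the lowering and raising operators, and let $\varphi_0(\eta,t)=\pi^{-1/4}Q^{-1/2}\exp(\tfrac i2PQ^{-1}\eta^2)$, $\varphi_{k+1}=\frac1{\sqrt{k+1}}\mathcal A^\dagger\varphi_k$ be the Hagedorn wave-packets. Let $\hat\Pi_N(t)f=\sum_{k=0}^N\langle\varphi_k(t),f\rangle\varphi_k(t)$, where $\langle\cdot,\cdot\rangle$ is the $L^2(\mathbb R)$ inner product, conjugate-linear in its first argument. Let $w\in C([0,T];L^2(\mathbb R))$ be a weak solution of $i\partial_tw=\hat H(t)w$ with arbitrary initial value $w(0)\in L^2(\mathbb R)$, that is, $i\frac{d}{dt}\langle g,w(t)\rangle=\langle\hat H(t)g,w(t)\rangle$ on $[0,T]$ for every Schwartz function $g$. Suppose that $\mathcal A(t)^mw(t)\in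 L^2(\mathbb R)$ (in the sense of tempered distributions) and that $$\|\mathcal A^mw(t)\|_{L^2}\le B(m,T)\,\|\mathcal A^mw(0)\|_{L^2}\qquad\text{for all }t\in[0,T].$$ Let $N\ge2$ and $m\le N+1$, and let $w_N$ be a Galerkin solution with $N+1$ wave-packets: $w_N(t)\in\operatorname{span}\{\varphi_0(t),\dots,\varphi_N(t)\}$, $i\partial_tw_N=\hat\Pi_N\hat H(t)w_N$ on $[0,T]$ and $w_N(0)=\hat\Pi_Nw(0)$. Then for all $t\in[0,T]$ $$\|w(t)-w_N(t)\|_{L^2}\le B_1\sqrt{\frac{(N-m+1)!}{(N+1)!}}\,\|\mathcal A^mw(0)\|_{L^2}+B_2\,T\,\frac{\varepsilon^{1/2}}{\tilde\alpha_I^{3/2}}\sqrt{\frac{(N-m+1)!}{(N-2)!}}\,\|\mathcal A^mw(0)\|_{L^2}.$$ -/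

import Mathlib

open MeasureTheory Set
open scoped SchwartzMap ComplexConjugate ContDiff Nat

noncomputable section

/-- `f'` is the weak (distributional) `n`-th derivative of `f : ℝ → ℝ`. -/
def IsWeakDeriv (n : ℕ) (f f' : ℝ → ℝ) : Prop :=
  LocallyIntegrable f' volume ∧
  ∀ g : ℝ → ℝ, ContDiff ℝ ∞ g → HasCompactSupport g →
    ∫ x, f x * iteratedDeriv n g x = (-1) ^ n * ∫ x, f' x * g x

/-- The parameters `q, p, α, B` of the one-dimensional Gaussian wave-packet transform on `[0, T]`
for the potential `V`. Here `α = α_R + i α_I`. -/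
structure IsGWPTParameters (V : ℝ → ℝ) (T : ℝ) (q p : ℝ → ℝ) (α : ℝ → ℂ) (B : ℝ → ℝ) : Prop where
  deriv_q : ∀ t ∈ Icc 0 T, HasDerivWithinAt q (p t) (Icc 0 T) t
  deriv_p : ∀ t ∈ Icc 0 T, HasDerivWithinAt p (-deriv V (q t)) (Icc 0 T) t
  deriv_α : ∀ t ∈ Icc 0 T,
    HasDerivWithinAt α (-2 * α t * α t - (1 / 2) * ((iteratedDeriv 2 V (q t) : ℝ) : ℂ)) (Icc 0 T) t
  deriv_B : ∀ t ∈ Icc 0 T, HasDerivWithinAt B (-2 * B t * (α t).re) (Icc 0 T) t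
  im_α_zero : 0 < (α 0).im
  B_zero : B 0 = √(α 0).im

/-- The parameters `Q_h, P_h` of the Hagedorn wave-packets on `[0, T]` (in one dimension, with
`q_h = p_h = 0`). -/
structure IsHWPParameters (T : ℝ) (B : ℝ → ℝ) (Q P : ℝ → ℂ) : Prop where
  deriv_Q : ∀ t ∈ Icc 0 T, HasDerivWithinAt Q ((B t : ℂ) ^ 2 * P t) (Icc 0 T) t
  deriv_P : ∀ t ∈ Icc 0 T, HasDerivWithinAt P (-4 * (B t : ℂ) ^ 2 * Q t) (Icc 0 T) t
  Q_zero : Q 0 = ((1 / √2 : ℝ) : ℂ)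
  P_zero : P 0 = Complex.I * ((√2 : ℝ) : ℂ)

/-- The raising operator `A† = (1/√2) (-i Q̄ p̂ + i P̄ x)`, `p̂ = -i d/dx`, on functions. -/
def raising (Q P : ℂ) (g : ℝ → ℂ) : ℝ → ℂ := fun x =>
  ((1 / √2 : ℝ) : ℂ) * (-Complex.I * conj Q * (-Complex.I * deriv g x)
    + Complex.I * conj P * (x : ℂ) * g x)

/-- The lowering operator `A = (1/√2) (i Q p̂ - i P x)`, `p̂ = -i d/dx`, on tempered distributions. -/
def lowering (Q P : ℂ) : 𝓢'(ℝ, ℂ) →L[ℂ] 𝓢'(ℝ, ℂ) :=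
  ((1 / √2 : ℝ) : ℂ) • ((Complex.I * Q) • ((-Complex.I) • TemperedDistribution.derivCLM ℂ)
    - (Complex.I * P) • TemperedDistribution.smulLeftCLM ℂ (fun x : ℝ => (x : ℂ)))

/-- The Hagedorn wave-packets `φ_k[0, 0, Q, P]` with semi-classical scale `δ = 1`. The branch of
`Q^{-1/2}` only affects a global sign. -/
def hwp (Q P : ℂ) : ℕ → ℝ → ℂ
  | 0 => fun x => ((Real.pi ^ (-(1 / 4) : ℝ) : ℝ) : ℂ) * Q ^ (-(1 / 2) : ℂ)
      * Complex.exp (Complex.I / 2 * (P * Q⁻¹) * (x : ℂ) ^ 2)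
  | k + 1 => fun x => ((1 / √((k : ℝ) + 1) : ℝ) : ℂ) * raising Q P (hwp Q P k) x

/-- The projection onto the span of `φ_0, …, φ_N`: `f ↦ ∑_{k ≤ N} ⟨φ_k, f⟩ φ_k`. -/
def hwpProj (Q P : ℂ) (N : ℕ) (f : ℝ → ℂ) : ℝ → ℂ := fun x =>
  ∑ k ∈ Finset.range (N + 1), (∫ y, conj (hwp Q P k y) * f y) * hwp Q P k x

/-- The residue potential `U(η; q)`. -/
def residuePotential (V : ℝ → ℝ) (ε q B η : ℝ) : ℝ :=
  1 / ε ^ (3 / 2 : ℝ) * (V (q + √ε * (B⁻¹ * η)) - V q - √ε * deriv V q * (B⁻¹ * η)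
    - ε / 2 * iteratedDeriv 2 V q * (B⁻¹ * η) ^ 2)

/-- The Hamiltonian `Ĥ = -½ B² d²/dη² + 2 B² η² + √ε U(η; q)` applied to a function. -/
def hamiltonian (V : ℝ → ℝ) (ε q B : ℝ) (g : ℝ → ℂ) : ℝ → ℂ := fun η =>
  -(1 / 2) * (B : ℂ) ^ 2 * iteratedDeriv 2 g η + 2 * (B : ℂ) ^ 2 * (η : ℂ) ^ 2 * g η
    + ((√ε * residuePotential V ε q B η : ℝ) : ℂ) * g η

/-- `w ∈ C([0, T]; L²(ℝ))` solves `i ∂ₜ w = Ĥ(t) w` in the weak sense: for every Schwartz function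
`g` one has `i d/dt ⟨g, w(t)⟩ = ⟨Ĥ(t) g, w(t)⟩` on `[0, T]`. -/
structure IsWSolution (V : ℝ → ℝ) (ε T : ℝ) (q B : ℝ → ℝ)
    (w : ℝ → Lp ℂ 2 (volume : Measure ℝ)) : Prop where
  continuousOn : ContinuousOn w (Icc 0 T)
  weak_eq : ∀ g : 𝓢(ℝ, ℂ), ∀ t ∈ Icc 0 T,
    HasDerivWithinAt (fun s => ∫ η, conj (g η) * w s η)
      (-Complex.I * ∫ η, conj (hamiltonian V ε (q t) (B t) g η) * w t η) (Icc 0 T) t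

/-- `wN` is the Galerkin solution with `N + 1` wave-packets on `[0, T]`: it takes values in the span
of `φ_0, …, φ_N`, solves `i ∂ₜ wN = Π_N Ĥ(t) wN`, and starts from `Π_N w₀`. -/
structure IsGalerkinSolution (V : ℝ → ℝ) (ε T : ℝ) (q B : ℝ → ℝ) (Q P : ℝ → ℂ) (N : ℕ)
    (w₀ : ℝ → ℂ) (wN : ℝ → ℝ → ℂ) : Prop where
  mem_span : ∀ t ∈ Icc 0 T, wN t ∈ Submodule.span ℂ (hwp (Q t) (P t) '' {k | k ≤ N})
  init : wN 0 = hwpProj (Q 0) (P 0) N w₀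
  galerkin_eq : ∀ t ∈ Icc 0 T, ∀ η : ℝ,
    HasDerivWithinAt (fun s => wN s η)
      (-Complex.I * hwpProj (Q t) (P t) N (hamiltonian V ε (q t) (B t) (wN t)) η) (Icc 0 T) t

end

/-!
Both `B²` and `Im α` solve `y' = -4 α_R y` with the same initial value, so `B² = Im α`
(`IsGWPTParameters.B_pos_and_im_eq`). Moreover `P - 2iQ` and `Q` keep their modulus along the flow,
hence `P = 2iQ` and `|Q|² = 1/2` for all times. The wave-packet `φ_k(t)` is therefore a phase times
a fixed real Hermite function `herm k` (`exists_phase_hwp`), and the projection `Π_N` does not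
depend on time.

Write `w = Π_N w + ρ` and let `f = Π_N w - w_N`, with Hermite coefficients `r_k`. The Hermite
functions diagonalise the oscillator part of the Hamiltonian, so that
`i r_k' = E_k r_k + ⟨h_k, W (f + ρ)⟩` with the real potential `W = √ε U`. In the derivative of
`∑ |r_k|² = ‖f‖²` the symmetric terms drop out and `(‖f‖²)' ≤ 2 ‖W f‖ ‖ρ‖` remains
(`two_mul_sum_re_le`). This puts `W` on the smooth finite combination `f`, not on `ρ`, for which
`W ρ` need not be in `L²`.

Three estimates finish the argument.
* Mollification shows that `V''` is Lipschitz, so Taylor's formula gives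
  `|U| ≤ L B⁻³ |η|³` (`abs_residuePotential_le`).
* Since `x = a + a†` up to a factor `1/2`, multiplication by `x³` costs at most
  `√(10 (N+1) N (N-1))` on the span of `h_0, …, h_N` (`norm_toLp_mulX_pow_three_le`).
* Testing `Aᵐ w` against `h_k` gives `√((k+m)!/k!) |⟨h_{k+m}, w⟩| = |⟨h_k, Aᵐ w⟩|`. Parseval's
  identity then bounds `ρ` by `√((N+1-m)!/(N+1)!) ‖Aᵐ w‖` (`norm_hermTail_le`). It needs the
  completeness of the Hermite functions, which follows from the injectivity of the Fourier
  transform (`hermBasis`).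
-/

noncomputable section

/-! ### The Gaussian as a Schwartz function -/

theorem exists_bound_polynomial_mul_gaussian (p : Polynomial ℂ) :
    ∃ C : ℝ, ∀ x : ℝ, ‖p.eval (x : ℂ)‖ * Real.exp (-x ^ 2) ≤ C := by
  induction p using Polynomial.induction_on' with
  | add p q hp hq =>
    obtain ⟨C, hC⟩ := hp
    obtain ⟨D, hD⟩ := hq
    refine ⟨C + D, fun x => ?_⟩
    rw [Polynomial.eval_add]
    have := mul_le_mul_of_nonneg_right (norm_add_le (p.eval (x : ℂ)) (q.eval (x : ℂ)))
      (Real.exp_pos (-x ^ 2)).le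
    linarith [hC x, hD x]
  | monomial n a =>
    refine ⟨‖a‖ * (1 + n !), fun x => ?_⟩
    rw [Polynomial.eval_monomial, norm_mul, norm_pow, Complex.norm_real, Real.norm_eq_abs,
      mul_assoc]
    refine mul_le_mul_of_nonneg_left ?_ (norm_nonneg a)
    have h1 : |x| ^ n ≤ 1 + (x ^ 2) ^ n := by
      rcases le_total |x| 1 with h | h
      · have := pow_le_one₀ (n := n) (abs_nonneg x) h
        have := pow_nonneg (sq_nonneg x) n
        linarith
      · have : |x| ^ n ≤ (|x| ^ 2) ^ n :=
          pow_le_pow_left₀ (abs_nonneg x) (by nlinarith) n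
        rw [sq_abs] at this
        linarith
    have h2 : (x ^ 2) ^ n * Real.exp (-x ^ 2) ≤ n ! := by
      have := Real.pow_div_factorial_le_exp (x ^ 2) (sq_nonneg x) n
      rw [div_le_iff₀ (by positivity)] at this
      rw [Real.exp_neg, ← div_eq_mul_inv, div_le_iff₀ (Real.exp_pos _)]
      linarith
    have h3 : Real.exp (-x ^ 2) ≤ 1 := Real.exp_le_one_iff.2 (by nlinarith [sq_nonneg x])
    nlinarith [Real.exp_pos (-x ^ 2)]

theorem hasDerivAt_cexp_neg_sq (x : ℝ) :
    HasDerivAt (fun y : ℝ => Complex.exp (-(y : ℂ) ^ 2))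
      (-2 * (x : ℂ) * Complex.exp (-(x : ℂ) ^ 2)) x := by
  have h : HasDerivAt (fun z : ℂ => Complex.exp (-z ^ 2))
      (-2 * (x : ℂ) * Complex.exp (-(x : ℂ) ^ 2)) (x : ℂ) := by
    refine ((hasDerivAt_pow 2 (x : ℂ)).fun_neg).cexp.congr_deriv ?_
    push_cast
    ring
  exact h.comp_ofReal

theorem exists_polynomial_iteratedDeriv_gaussian (n : ℕ) :
    ∃ p : Polynomial ℂ, iteratedDeriv n (fun y : ℝ => Complex.exp (-(y : ℂ) ^ 2)) =
      fun x : ℝ => p.eval (x : ℂ) * Complex.exp (-(x : ℂ) ^ 2) := by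
  induction n with
  | zero => exact ⟨1, by simp⟩
  | succ n ih =>
    obtain ⟨p, hp⟩ := ih
    refine ⟨p.derivative - 2 * Polynomial.X * p, ?_⟩
    rw [iteratedDeriv_succ, hp]
    funext x
    rw [(((p.hasDerivAt (x : ℂ)).comp_ofReal).fun_mul (hasDerivAt_cexp_neg_sq x)).deriv]
    simp
    ring

/-- The Gaussian `x ↦ exp (-x²)`. -/
def gaussianSchwartz : 𝓢(ℝ, ℂ) where
  toFun x := Complex.exp (-(x : ℂ) ^ 2)
  smooth' := ((Complex.ofRealCLM.contDiff.pow 2).neg).cexp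
  decay' k n := by
    obtain ⟨p, hp⟩ := exists_polynomial_iteratedDeriv_gaussian n
    obtain ⟨C, hC⟩ := exists_bound_polynomial_mul_gaussian (Polynomial.X ^ k * p)
    refine ⟨C, fun x => le_trans (le_of_eq ?_) (hC x)⟩
    rw [norm_iteratedFDeriv_eq_norm_iteratedDeriv, hp]
    simp [Complex.norm_exp, mul_assoc, ← Complex.ofReal_pow]

theorem gaussianSchwartz_apply (x : ℝ) :
    gaussianSchwartz x = Complex.exp (-(x : ℂ) ^ 2) := rfl

/-! ### Ladder operators and Hermite functions -/

/-- Multiplication by the coordinate on Schwartz functions. -/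
def mulX : 𝓢(ℝ, ℂ) →L[ℂ] 𝓢(ℝ, ℂ) := SchwartzMap.smulLeftCLM ℂ (fun x : ℝ => (x : ℂ))

/-- The raising operator `a† = (-∂ + 2x) / 2` on Schwartz functions. -/
def raise : 𝓢(ℝ, ℂ) →L[ℂ] 𝓢(ℝ, ℂ) := mulX - (1 / 2 : ℂ) • SchwartzMap.derivCLM ℂ ℂ

/-- The lowering operator `a = (∂ + 2x) / 2` on Schwartz functions. -/
def lower : 𝓢(ℝ, ℂ) →L[ℂ] 𝓢(ℝ, ℂ) := mulX + (1 / 2 : ℂ) • SchwartzMap.derivCLM ℂ ℂ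

theorem mulX_apply (f : 𝓢(ℝ, ℂ)) (x : ℝ) : mulX f x = x * f x := by
  rw [mulX, SchwartzMap.smulLeftCLM_apply_apply Function.Complex.hasTemperateGrowth_ofReal,
    smul_eq_mul]

theorem raise_apply (f : 𝓢(ℝ, ℂ)) (x : ℝ) : raise f x = x * f x - 1 / 2 * deriv f x := by
  simp [raise, mulX_apply]

theorem lower_apply (f : 𝓢(ℝ, ℂ)) (x : ℝ) : lower f x = x * f x + 1 / 2 * deriv f x := by
  simp [lower, mulX_apply]

theorem hasDerivAt_ofReal_mul_schwartz (f : 𝓢(ℝ, ℂ)) (x : ℝ) :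
    HasDerivAt (fun y : ℝ => (y : ℂ) * f y) (f x + x * deriv f x) x := by
  have h : HasDerivAt (fun y : ℝ => (y : ℂ)) 1 x := (hasDerivAt_id x).ofReal_comp
  exact (h.fun_mul (f.hasDerivAt x)).congr_deriv (by ring)

theorem mulX_eq (f : 𝓢(ℝ, ℂ)) : mulX f = (1 / 2 : ℂ) • (raise f + lower f) := by
  ext x
  simp [raise_apply, lower_apply, mulX_apply]
  ring

theorem deriv_raise (f : 𝓢(ℝ, ℂ)) (x : ℝ) :
    deriv (raise f) x = f x + x * deriv f x - 1 / 2 * deriv (deriv f) x := by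
  rw [show (raise f : ℝ → ℂ) = fun y : ℝ => (y : ℂ) * f y - 1 / 2 * deriv f y from
    funext (raise_apply f)]
  exact ((hasDerivAt_ofReal_mul_schwartz f x).sub
    (((SchwartzMap.derivCLM ℂ ℂ f).hasDerivAt x).const_mul (1 / 2))).deriv

theorem deriv_lower (f : 𝓢(ℝ, ℂ)) (x : ℝ) :
    deriv (lower f) x = f x + x * deriv f x + 1 / 2 * deriv (deriv f) x := by
  rw [show (lower f : ℝ → ℂ) = fun y : ℝ => (y : ℂ) * f y + 1 / 2 * deriv f y from
    funext (lower_apply f)]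
  exact ((hasDerivAt_ofReal_mul_schwartz f x).add
    (((SchwartzMap.derivCLM ℂ ℂ f).hasDerivAt x).const_mul (1 / 2))).deriv

/-- The canonical commutation relation `a a† = a† a + 1`. -/
theorem lower_raise (f : 𝓢(ℝ, ℂ)) : lower (raise f) = raise (lower f) + f := by
  ext x
  simp only [add_apply, lower_apply (raise f), raise_apply (lower f), deriv_raise,
    deriv_lower, raise_apply f, lower_apply f]
  ring

/-- The harmonic oscillator is twice the number operator plus one. -/
theorem oscillator_eq (f : 𝓢(ℝ, ℂ)) (x : ℝ) :
    -(1 / 2) * iteratedDeriv 2 f x + 2 * (x : ℂ) ^ 2 * f x = 2 * raise (lower f) x + f x := by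
  rw [iteratedDeriv_succ, iteratedDeriv_one, raise_apply (lower f), deriv_lower, lower_apply]
  ring

/-- `raise` and `lower` are transposes of each other for the bilinear pairing. -/
theorem integral_raise_mul (f g : 𝓢(ℝ, ℂ)) :
    ∫ x, raise f x * g x = ∫ x, f x * lower g x := by
  have hfg : Integrable (fun x => mulX f x * g x) :=
    (SchwartzMap.pairing (ContinuousLinearMap.mul ℂ ℂ) (mulX f) g).integrable
  have hfg' : Integrable (fun x => f x * mulX g x) :=
    (SchwartzMap.pairing (ContinuousLinearMap.mul ℂ ℂ) f (mulX g)).integrable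
  have h1 : Integrable (fun x => deriv f x * g x) :=
    (SchwartzMap.pairing (ContinuousLinearMap.mul ℂ ℂ) (SchwartzMap.derivCLM ℂ ℂ f) g).integrable
  have h2 : Integrable (fun x => f x * deriv g x) :=
    (SchwartzMap.pairing (ContinuousLinearMap.mul ℂ ℂ) f (SchwartzMap.derivCLM ℂ ℂ g)).integrable
  have e1 : ∀ x, raise f x * g x = mulX f x * g x - 1 / 2 * (deriv f x * g x) := fun x => by
    rw [raise_apply, mulX_apply]; ring
  have e2 : ∀ x, f x * lower g x = f x * mulX g x + 1 / 2 * (f x * deriv g x) := fun x => by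
    rw [lower_apply, mulX_apply]; ring
  simp only [e1, e2]
  rw [integral_sub hfg (h1.const_mul _), integral_add hfg' (h2.const_mul _),
    integral_const_mul, integral_const_mul, SchwartzMap.integral_mul_deriv_eq_neg_deriv_mul]
  simp only [mulX_apply]
  have e3 : ∀ x : ℝ, (x : ℂ) * f x * g x = f x * (x * g x) := fun x => by ring
  simp only [e3]
  ring

/-- The normalised Hermite functions for the weight `exp (-2x²)`. -/
def herm : ℕ → 𝓢(ℝ, ℂ)
  | 0 => (((2 / Real.pi) ^ (1 / 4 : ℝ) : ℝ) : ℂ) • gaussianSchwartz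
  | k + 1 => ((1 / √((k : ℝ) + 1) : ℝ) : ℂ) • raise (herm k)

theorem raise_herm (k : ℕ) : raise (herm k) = ((√((k : ℝ) + 1) : ℝ) : ℂ) • herm (k + 1) := by
  have : √((k : ℝ) + 1) ≠ 0 := by positivity
  rw [herm, smul_smul, ← Complex.ofReal_mul, mul_one_div_cancel this, Complex.ofReal_one, one_smul]

theorem lower_herm_zero : lower (herm 0) = 0 := by
  ext x
  have : deriv gaussianSchwartz x = -2 * (x : ℂ) * Complex.exp (-(x : ℂ) ^ 2) :=
    (hasDerivAt_cexp_neg_sq x).deriv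
  simp only [herm, map_smul, smul_apply, lower_apply, this, gaussianSchwartz_apply,
    zero_apply, smul_eq_mul]
  ring

theorem lower_herm_succ (k : ℕ) :
    lower (herm (k + 1)) = ((√((k : ℝ) + 1) : ℝ) : ℂ) • herm k := by
  have key : ∀ k : ℕ, raise (lower (herm k)) = (k : ℂ) • herm k →
      lower (herm (k + 1)) = ((√((k : ℝ) + 1) : ℝ) : ℂ) • herm k := by
    intro k h
    rw [herm, map_smul, lower_raise, h,
      show (k : ℂ) • herm k + herm k = ((k : ℂ) + 1) • herm k by module, smul_smul]
    congr 1
    have h0 : (0 : ℝ) ≤ (k : ℝ) + 1 := by positivity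
    have : 1 / √((k : ℝ) + 1) * ((k : ℝ) + 1) = √((k : ℝ) + 1) := by
      rw [one_div_mul_eq_div, Real.div_sqrt]
    exact_mod_cast this
  refine key k ?_
  induction k with
  | zero => simp [lower_herm_zero]
  | succ k ih =>
    rw [key k ih, map_smul, raise_herm, smul_smul, ← Complex.ofReal_mul,
      Real.mul_self_sqrt (by positivity)]
    push_cast
    rfl

theorem raise_lower_herm (k : ℕ) : raise (lower (herm k)) = (k : ℂ) • herm k := by
  cases k with
  | zero => simp [lower_herm_zero]
  | succ k =>
    rw [lower_herm_succ, map_smul, raise_herm, smul_smul, ← Complex.ofReal_mul,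
      Real.mul_self_sqrt (by positivity)]
    push_cast
    rfl

theorem conj_herm (k : ℕ) (x : ℝ) : conj (herm k x) = herm k x := by
  have key : ∀ f : 𝓢(ℝ, ℂ), (∀ x, conj (f x) = f x) → ∀ x, conj (raise f x) = raise f x := by
    intro f hf x
    have : conj (deriv f x) = deriv f x := by
      have h := (f.hasDerivAt x).star
      simp only [RCLike.star_def, hf] at h
      exact (h.unique (f.hasDerivAt x))
    rw [raise_apply, map_sub, map_mul, map_mul, hf, this, Complex.conj_ofReal]
    rw [map_div₀, map_one, map_ofNat]
  induction k generalizing x with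
  | zero =>
    simp only [herm, smul_apply, smul_eq_mul, map_mul, Complex.conj_ofReal,
      gaussianSchwartz_apply, ← Complex.exp_conj]
    simp
  | succ k ih =>
    simp only [herm, smul_apply, smul_eq_mul, map_mul, Complex.conj_ofReal, key _ ih]

theorem integral_herm_zero_mul : ∫ x, herm 0 x * herm 0 x = 1 := by
  have e : ∀ x : ℝ, herm 0 x * herm 0 x =
      ((((2 / Real.pi) ^ (1 / 2 : ℝ) * Real.exp (-2 * x ^ 2) : ℝ)) : ℂ) := by
    intro x
    have h : (2 / Real.pi : ℝ) ^ (1 / 2 : ℝ) =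
        (2 / Real.pi : ℝ) ^ (1 / 4 : ℝ) * (2 / Real.pi : ℝ) ^ (1 / 4 : ℝ) := by
      rw [← Real.rpow_add (by positivity)]; norm_num
    have h' : Real.exp (-2 * x ^ 2) = Real.exp (-x ^ 2) * Real.exp (-x ^ 2) := by
      rw [← Real.exp_add]; ring_nf
    rw [h, h']
    simp only [herm, smul_apply, smul_eq_mul, gaussianSchwartz_apply]
    push_cast
    ring
  simp only [e]
  rw [integral_complex_ofReal, integral_const_mul, integral_gaussian, ← Real.sqrt_eq_rpow,
    ← Real.sqrt_mul (by positivity)]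
  rw [show 2 / Real.pi * (Real.pi / 2) = 1 by field_simp]
  simp

theorem integral_herm_mul_herm (j k : ℕ) :
    ∫ x, herm j x * herm k x = if j = k then 1 else 0 := by
  induction j generalizing k with
  | zero =>
    cases k with
    | zero => simpa using integral_herm_zero_mul
    | succ k =>
      have e : ∀ x, herm 0 x * herm (k + 1) x =
          ((1 / √((k : ℝ) + 1) : ℝ) : ℂ) * (raise (herm k) x * herm 0 x) := fun x => by
        rw [herm.eq_2, smul_apply, smul_eq_mul]; ring
      simp only [e]
      rw [integral_const_mul, integral_raise_mul]
      simp [lower_herm_zero]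
  | succ j ih =>
    have e : ∀ x, herm (j + 1) x * herm k x =
        ((1 / √((j : ℝ) + 1) : ℝ) : ℂ) * (raise (herm j) x * herm k x) := fun x => by
      rw [herm, smul_apply, smul_eq_mul]; ring
    simp only [e]
    rw [integral_const_mul, integral_raise_mul]
    cases k with
    | zero => simp [lower_herm_zero]
    | succ k =>
      have e2 : ∀ x, herm j x * lower (herm (k + 1)) x =
          ((√((k : ℝ) + 1) : ℝ) : ℂ) * (herm j x * herm k x) := fun x => by
        rw [lower_herm_succ, smul_apply, smul_eq_mul]; ring
      simp only [e2]
      rw [integral_const_mul, ih]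
      by_cases h : j = k
      · subst h
        have : √((j : ℝ) + 1) ≠ 0 := by positivity
        simp [this]
      · simp [h]

/-! ### Completeness of the Hermite functions -/

open scoped FourierTransform in
theorem ae_eq_zero_of_fourier_eq_zero {F : ℝ → ℂ} (hF : Integrable F) (h : ∀ ξ, 𝓕 F ξ = 0) :
    ∀ᵐ x, F x = 0 := by
  refine ae_eq_zero_of_integral_contDiff_smul_eq_zero hF.locallyIntegrable fun g hg hgc => ?_
  have hg₁ : HasCompactSupport (Complex.ofRealCLM ∘ g) := hgc.comp_left rfl
  have hg₂ : ContDiff ℝ ∞ (Complex.ofRealCLM ∘ g) := by fun_prop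
  set G : 𝓢(ℝ, ℂ) := hg₁.toSchwartzMap hg₂
  have hG : ∀ x, 𝓕 (𝓕⁻ G : 𝓢(ℝ, ℂ)) x = (g x : ℂ) := fun x => by
    rw [FourierTransform.fourier_fourierInv_eq]; rfl
  have key := VectorFourier.integral_fourierIntegral_smul_eq_flip (L := innerₗ ℝ)
    Real.continuous_fourierChar continuous_inner hF
    ((𝓕⁻ G : 𝓢(ℝ, ℂ)).integrable (μ := volume))
  have h1 : ∀ ξ, VectorFourier.fourierIntegral Real.fourierChar volume (innerₗ ℝ) F ξ = 0 := h
  have h2 : ∀ x, VectorFourier.fourierIntegral Real.fourierChar volume (innerₗ ℝ).flip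
      (𝓕⁻ G : 𝓢(ℝ, ℂ)) x = (g x : ℂ) := fun x => by
    rw [flip_innerₗ]; exact hG x
  simp only [h1, h2, smul_eq_mul, zero_mul, integral_zero] at key
  rw [key]
  exact integral_congr_ae (.of_forall fun x => by simp [mul_comm])

/-- The three-term recurrence: `x hₖ` is a combination of `hₖ₋₁` and `hₖ₊₁`. -/
theorem mulX_herm_mem_span (k : ℕ) :
    mulX (herm k) ∈ Submodule.span ℂ (range herm) := by
  have h : ∀ j, herm j ∈ Submodule.span ℂ (range herm) := fun j =>
    Submodule.subset_span ⟨j, rfl⟩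
  rw [mulX_eq]
  refine Submodule.smul_mem _ _ (Submodule.add_mem _ ?_ ?_)
  · rw [raise_herm]; exact Submodule.smul_mem _ _ (h _)
  · cases k with
    | zero => rw [lower_herm_zero]; exact Submodule.zero_mem _
    | succ k => rw [lower_herm_succ]; exact Submodule.smul_mem _ _ (h _)

theorem mulX_pow_herm_mem_span (n : ℕ) :
    (mulX ^ n) (herm 0) ∈ Submodule.span ℂ (range herm) := by
  induction n with
  | zero => exact Submodule.subset_span ⟨0, rfl⟩
  | succ n ih =>
    rw [pow_succ', mul_apply_eq_comp]
    have : Submodule.span ℂ (range herm) ≤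
        (Submodule.span ℂ (range herm)).comap (mulX : 𝓢(ℝ, ℂ) →ₗ[ℂ] 𝓢(ℝ, ℂ)) := by
      rw [Submodule.span_le]
      rintro _ ⟨k, rfl⟩
      exact mulX_herm_mem_span k
    exact this ih

theorem mulX_pow_apply (n : ℕ) (f : 𝓢(ℝ, ℂ)) (x : ℝ) :
    (mulX ^ n) f x = (x : ℂ) ^ n * f x := by
  induction n with
  | zero => simp
  | succ n ih => rw [pow_succ', mul_apply_eq_comp, mulX_apply, ih]; ring

theorem exp_abs_mul_gaussian_le (c x : ℝ) :
    Real.exp (|c * x|) * Real.exp (-x ^ 2) ≤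
      Real.exp (c ^ 2 / 2) * Real.exp (-(1 / 2) * x ^ 2) := by
  rw [← Real.exp_add, ← Real.exp_add, Real.exp_le_exp]
  rcases abs_cases (c * x) with ⟨h, _⟩ | ⟨h, _⟩ <;> rw [h] <;>
    nlinarith [sq_nonneg (c - x), sq_nonneg (c + x)]

theorem memLp_two_exp_neg_half_sq :
    MemLp (fun x : ℝ => Real.exp (-(1 / 2) * x ^ 2)) 2 volume := by
  rw [memLp_two_iff_integrable_sq (by fun_prop)]
  refine (integrable_exp_neg_mul_sq (b := 1) one_pos).congr (.of_forall fun x => ?_)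
  change Real.exp (-1 * x ^ 2) = Real.exp (-(1 / 2) * x ^ 2) ^ 2
  rw [← Real.exp_nat_mul]
  congr 1
  push_cast
  ring

theorem integrable_exp_abs_mul_gaussian_mul (f : Lp ℂ 2 (volume : Measure ℝ)) (c : ℝ) :
    Integrable (fun x : ℝ => Real.exp |c * x| * (Real.exp (-x ^ 2) * ‖f x‖)) := by
  have h : Integrable (fun x : ℝ => Real.exp (-(1 / 2) * x ^ 2) * ‖f x‖) :=
    memLp_two_exp_neg_half_sq.integrable_mul (Lp.memLp f).norm
  refine (h.const_mul (Real.exp (c ^ 2 / 2))).mono' ?_ (.of_forall fun x => ?_)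
  · exact (by fun_prop : Continuous fun x : ℝ => Real.exp |c * x|).aestronglyMeasurable.mul
      ((by fun_prop : Continuous fun x : ℝ => Real.exp (-x ^ 2)).aestronglyMeasurable.mul
        (Lp.aestronglyMeasurable f).norm)
  · rw [Real.norm_of_nonneg (by positivity), ← mul_assoc, ← mul_assoc]
    exact mul_le_mul_of_nonneg_right (exp_abs_mul_gaussian_le c x) (norm_nonneg _)

/-- An `L²` function all of whose Gaussian-weighted moments vanish is zero: the Fourier transform
of its product with the Gaussian is an everywhere convergent series of these moments. -/
theorem eq_zero_of_gaussian_moments_eq_zero (f : Lp ℂ 2 (volume : Measure ℝ))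
    (h : ∀ n : ℕ, ∫ x : ℝ, (x : ℂ) ^ n * (Complex.exp (-(x : ℂ) ^ 2) * f x) = 0) : f = 0 := by
  set F : ℝ → ℂ := fun x => Complex.exp (-(x : ℂ) ^ 2) * f x with hF
  have hnorm : ∀ x, ‖F x‖ = Real.exp (-x ^ 2) * ‖f x‖ := fun x => by
    rw [hF, norm_mul, Complex.norm_exp]
    norm_num [← Complex.ofReal_pow]
  have hmeas : AEStronglyMeasurable F volume :=
    gaussianSchwartz.continuous.aestronglyMeasurable.mul (Lp.aestronglyMeasurable f)
  have hint : Integrable F := by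
    refine (integrable_exp_abs_mul_gaussian_mul f 0).mono' hmeas (.of_forall fun x => ?_)
    simp [hnorm]
  have hF0 : ∀ᵐ x, F x = 0 := by
    refine ae_eq_zero_of_fourier_eq_zero hint fun ξ => ?_
    rw [Real.fourier_real_eq_integral_exp_smul]
    set c : ℂ := -2 * Real.pi * ξ * Complex.I with hc
    have hcn : ‖c‖ = |2 * Real.pi * ξ| := by
      rw [hc]; simp [abs_mul]
    have hsum : ∀ x : ℝ, HasSum (fun n : ℕ => (‖c‖ * |x|) ^ n / n ! * ‖F x‖)
        (Real.exp |(2 * Real.pi * ξ) * x| * (Real.exp (-x ^ 2) * ‖f x‖)) := fun x => by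
      rw [← hnorm, abs_mul, ← hcn]
      refine HasSum.mul_right _ ?_
      rw [Real.exp_eq_exp_ℝ]
      exact NormedSpace.expSeries_div_hasSum_exp (𝔸 := ℝ) _
    have := hasSum_integral_of_dominated_convergence (μ := volume)
      (F := fun (n : ℕ) (x : ℝ) => (c * x) ^ n / n ! * F x)
      (f := fun x : ℝ => Complex.exp (c * x) * F x)
      (fun n x => (‖c‖ * |x|) ^ n / n ! * ‖F x‖)
      (fun n => by
        exact (by fun_prop : Continuous fun x : ℝ =>
          (c * (x : ℂ)) ^ n / (n ! : ℂ)).aestronglyMeasurable.mul hmeas)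
      (fun n => .of_forall fun x => by simp [Complex.norm_real])
      (.of_forall fun x => (hsum x).summable)
      ((integrable_exp_abs_mul_gaussian_mul f (2 * Real.pi * ξ)).congr
        (.of_forall fun x => (hsum x).tsum_eq.symm))
      (.of_forall fun x => by
        refine HasSum.mul_right _ ?_
        rw [Complex.exp_eq_exp_ℂ]
        exact NormedSpace.expSeries_div_hasSum_exp (𝔸 := ℂ) _)
    have hz : ∀ n : ℕ, ∫ x : ℝ, (c * x) ^ n / n ! * F x = 0 := fun n => by
      have e : ∀ x : ℝ, (c * x) ^ n / n ! * F x = c ^ n / n ! * ((x : ℂ) ^ n * F x) := fun x => by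
        ring
      simp only [e]
      rw [integral_const_mul, h n, mul_zero]
    simp only [hz] at this
    rw [← this.unique hasSum_zero]
    refine integral_congr_ae (.of_forall fun x => ?_)
    simp only [smul_eq_mul, hc]
    congr 2
    push_cast
    ring
  rw [Lp.eq_zero_iff_ae_eq_zero]
  filter_upwards [hF0] with x hx
  exact (mul_eq_zero.1 hx).resolve_left (Complex.exp_ne_zero _)

theorem eq_zero_of_integral_herm_mul_eq_zero (f : Lp ℂ 2 (volume : Measure ℝ))
    (h : ∀ k : ℕ, ∫ x, herm k x * f x = 0) : f = 0 := by
  refine eq_zero_of_gaussian_moments_eq_zero f fun n => ?_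
  have hle : Submodule.span ℂ (range herm) ≤ LinearMap.ker
      ((Lp.toTemperedDistribution f : 𝓢'(ℝ, ℂ)) : 𝓢(ℝ, ℂ) →ₗ[ℂ] ℂ) := by
    rw [Submodule.span_le]
    rintro _ ⟨k, rfl⟩
    simpa using h k
  have h0 := hle (mulX_pow_herm_mem_span n)
  have h1 : ∫ x : ℝ, ((mulX ^ n) (herm 0)) x * f x = 0 := by simpa using h0
  have hc : ((((2 / Real.pi) ^ (1 / 4 : ℝ) : ℝ)) : ℂ) ≠ 0 := by
    have : (0 : ℝ) < (2 / Real.pi) ^ (1 / 4 : ℝ) := by positivity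
    exact_mod_cast this.ne'
  have e : ∀ x : ℝ, ((mulX ^ n) (herm 0)) x * f x = ((((2 / Real.pi) ^ (1 / 4 : ℝ) : ℝ)) : ℂ) *
      ((x : ℂ) ^ n * (Complex.exp (-(x : ℂ) ^ 2) * f x)) := fun x => by
    rw [mulX_pow_apply, herm.eq_1, smul_apply, smul_eq_mul, gaussianSchwartz_apply]; ring
  simp only [e] at h1
  rw [integral_const_mul] at h1
  exact (mul_eq_zero.1 h1).resolve_left hc

/-- The Hermite functions as elements of `L²`. -/
def hermLp (k : ℕ) : Lp ℂ 2 (volume : Measure ℝ) := (herm k).toLp 2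

theorem inner_schwartz_toLp (g : 𝓢(ℝ, ℂ)) (f : Lp ℂ 2 (volume : Measure ℝ)) :
    inner ℂ (g.toLp 2) f = ∫ x, conj (g x) * f x := by
  rw [L2.inner_def]
  refine integral_congr_ae ?_
  filter_upwards [g.coeFn_toLp 2 volume] with x hx
  rw [hx, RCLike.inner_apply, mul_comm]

theorem inner_hermLp (k : ℕ) (f : Lp ℂ 2 (volume : Measure ℝ)) :
    inner ℂ (hermLp k) f = ∫ x, herm k x * f x := by
  simp only [hermLp, inner_schwartz_toLp, conj_herm]

theorem orthonormal_hermLp : Orthonormal ℂ hermLp := by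
  rw [orthonormal_iff_ite]
  intro i j
  rw [inner_hermLp, ← integral_herm_mul_herm i j]
  refine integral_congr_ae ?_
  filter_upwards [(herm j).coeFn_toLp 2 volume] with x hx
  rw [← hx, hermLp]

/-- The Hermite functions as a Hilbert basis of `L²(ℝ)`. -/
def hermBasis : HilbertBasis ℕ ℂ (Lp ℂ 2 (volume : Measure ℝ)) :=
  HilbertBasis.mkOfOrthogonalEqBot orthonormal_hermLp (by
    rw [Submodule.eq_bot_iff]
    intro f hf
    refine eq_zero_of_integral_herm_mul_eq_zero f fun k => ?_
    rw [← inner_hermLp]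
    exact hf _ (Submodule.subset_span ⟨k, rfl⟩))

theorem hasSum_sq_norm_inner_hermLp (f : Lp ℂ 2 (volume : Measure ℝ)) :
    HasSum (fun k => ‖inner ℂ (hermLp k) f‖ ^ 2) (‖f‖ ^ 2) := by
  have h := hermBasis.hasSum_inner_mul_inner f f
  have hb : ⇑hermBasis = hermLp := HilbertBasis.coe_mkOfOrthogonalEqBot _ _
  rw [hb] at h
  have h2 := Complex.hasSum_re h
  convert h2 using 1
  · funext k
    rw [← inner_conj_symm f, ← Complex.normSq_eq_conj_mul_self, Complex.ofReal_re,
      Complex.normSq_eq_norm_sq]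
  · rw [← inner_self_eq_norm_sq (𝕜 := ℂ)]; rfl

/-! ### The parameters of the wave-packets -/

theorem eq_of_hasDerivWithinAt_zero {E : Type*} [NormedAddCommGroup E] [NormedSpace ℝ E]
    {T : ℝ} {f : ℝ → E} (hf : ∀ t ∈ Icc 0 T, HasDerivWithinAt f 0 (Icc 0 T) t) :
    ∀ t ∈ Icc 0 T, f t = f 0 := by
  refine constant_of_has_deriv_right_zero (fun t ht => (hf t ht).continuousWithinAt) fun t ht => ?_
  exact (hf t ⟨ht.1, ht.2.le⟩).mono_of_mem_nhdsWithin (Icc_mem_nhdsGE_of_mem ht)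

theorem exists_primitive_Icc {T : ℝ} (hT : 0 ≤ T) {f : ℝ → ℝ} (hf : ContinuousOn f (Icc 0 T)) :
    ∃ G : ℝ → ℝ, G 0 = 0 ∧ ∀ t ∈ Icc 0 T, HasDerivWithinAt G (f t) (Icc 0 T) t := by
  have hc : Continuous (IccExtend hT (fun x : Icc (0 : ℝ) T => f x)) :=
    (continuousOn_iff_continuous_domRestrict.1 hf).Icc_extend'
  refine ⟨fun t => ∫ s in (0 : ℝ)..t, IccExtend hT (fun x : Icc (0 : ℝ) T => f x) s, by simp,
    fun t ht => ?_⟩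
  have := intervalIntegral.integral_hasDerivAt_right (hc.intervalIntegrable 0 t)
    (hc.stronglyMeasurableAtFilter _ _) hc.continuousAt
  rw [IccExtend_of_mem hT _ ht] at this
  exact this.hasDerivWithinAt

namespace IsGWPTParameters

variable {V : ℝ → ℝ} {T : ℝ} {q p : ℝ → ℝ} {α : ℝ → ℂ} {B : ℝ → ℝ}

theorem hasDerivWithinAt_im (h : IsGWPTParameters V T q p α B) {t : ℝ} (ht : t ∈ Icc 0 T) :
    HasDerivWithinAt (fun s => (α s).im) (-4 * (α t).re * (α t).im) (Icc 0 T) t := by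
  have := (Complex.imCLM.hasFDerivAt.comp_hasDerivWithinAt t (h.deriv_α t ht))
  refine this.congr_deriv ?_
  rw [Complex.imCLM_apply]
  simp
  ring

/-- Both `B²` and `Im α` solve `y' = -4 (Re α) y`, hence they are the same multiple of the same
exponential. -/
theorem B_pos_and_im_eq (h : IsGWPTParameters V T q p α B) (hT : 0 ≤ T) {t : ℝ}
    (ht : t ∈ Icc 0 T) : 0 < B t ∧ (α t).im = B t ^ 2 := by
  obtain ⟨G, hG0, hG⟩ := exists_primitive_Icc hT (f := fun t => (α t).re) fun t ht =>
    (Complex.continuous_re.continuousAt.comp_continuousWithinAt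
      (h.deriv_α t ht).continuousWithinAt)
  have h1 := eq_of_hasDerivWithinAt_zero (f := fun t => B t * Real.exp (2 * G t)) (T := T)
    (fun t ht => ((h.deriv_B t ht).mul (((hG t ht).const_mul 2).exp)).congr_deriv (by ring)) t ht
  have h2 := eq_of_hasDerivWithinAt_zero (f := fun t => (α t).im * Real.exp (4 * G t)) (T := T)
    (fun t ht => ((h.hasDerivWithinAt_im ht).mul (((hG t ht).const_mul 4).exp)).congr_deriv
      (by ring)) t ht
  have h0 := h.im_α_zero
  simp only [hG0, mul_zero, Real.exp_zero, mul_one, h.B_zero] at h1 h2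
  have hB : 0 < B t * Real.exp (2 * G t) := by rw [h1]; exact Real.sqrt_pos.2 h0
  refine ⟨pos_of_mul_pos_left hB (Real.exp_pos _).le, ?_⟩
  refine mul_right_cancel₀ (Real.exp_pos (4 * G t)).ne' ?_
  rw [h2, show 4 * G t = 2 * G t + 2 * G t by ring, Real.exp_add]
  calc (α 0).im = √(α 0).im * √(α 0).im := (Real.mul_self_sqrt h0.le).symm
    _ = _ := by rw [← h1]; ring

/-- `B⁻³ ≤ (min Im α)^(-3/2)`. -/
theorem inv_B_pow_three_le (h : IsGWPTParameters V T q p α B) (hT : 0 ≤ T) {t : ℝ}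
    (ht : t ∈ Icc 0 T) :
    (B t)⁻¹ ^ 3 ≤ 1 / (sInf ((fun s => (α s).im) '' Icc 0 T)) ^ (3 / 2 : ℝ) := by
  have hc : ContinuousOn (fun s => (α s).im) (Icc 0 T) := fun s hs =>
    (h.hasDerivWithinAt_im hs).continuousWithinAt
  have hcomp : IsCompact ((fun s => (α s).im) '' Icc 0 T) := isCompact_Icc.image_of_continuousOn hc
  have hne : ((fun s => (α s).im) '' Icc 0 T).Nonempty := ⟨_, mem_image_of_mem _ ht⟩
  obtain ⟨s, hs, hs'⟩ := hcomp.sInf_mem hne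
  have hle : sInf ((fun s => (α s).im) '' Icc 0 T) ≤ B t ^ 2 := by
    rw [← (h.B_pos_and_im_eq hT ht).2]
    exact csInf_le hcomp.bddBelow (mem_image_of_mem _ ht)
  have hpos : 0 < sInf ((fun s => (α s).im) '' Icc 0 T) := by
    rw [← hs']
    obtain ⟨h1, h2⟩ := h.B_pos_and_im_eq hT hs
    simp only [h2]
    positivity
  have hB := (h.B_pos_and_im_eq hT ht).1
  rw [inv_pow, ← one_div]
  refine one_div_le_one_div_of_le (by positivity) ?_
  calc _ ≤ (B t ^ 2) ^ (3 / 2 : ℝ) := Real.rpow_le_rpow hpos.le hle (by norm_num)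
    _ = B t ^ 3 := by
      rw [← Real.rpow_natCast, ← Real.rpow_mul hB.le, ← Real.rpow_natCast]
      norm_num

end IsGWPTParameters

theorem norm_sq_eq_of_hasDerivWithinAt_mul_I {T : ℝ} {f : ℝ → ℂ} {r : ℝ → ℝ}
    (hf : ∀ t ∈ Icc 0 T, HasDerivWithinAt f ((r t : ℂ) * Complex.I * f t) (Icc 0 T) t) :
    ∀ t ∈ Icc 0 T, ‖f t‖ ^ 2 = ‖f 0‖ ^ 2 :=
  eq_of_hasDerivWithinAt_zero fun t ht => ((hf t ht).norm_sq).congr_deriv (by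
    simp [Complex.inner]
    ring)

/-- `P - 2iQ` vanishes initially and satisfies `Z' = -2i B² Z`, which preserves its modulus. -/
theorem IsHWPParameters.P_eq {T : ℝ} {B : ℝ → ℝ} {Q P : ℝ → ℂ} (h : IsHWPParameters T B Q P)
    {t : ℝ} (ht : t ∈ Icc 0 T) : P t = 2 * Complex.I * Q t := by
  have hd : ∀ t ∈ Icc 0 T, HasDerivWithinAt (fun s => P s - 2 * Complex.I * Q s)
      (((-2 * B t ^ 2 : ℝ) : ℂ) * Complex.I * (P t - 2 * Complex.I * Q t)) (Icc 0 T) t :=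
    fun t ht => ((h.deriv_P t ht).sub ((h.deriv_Q t ht).const_mul (2 * Complex.I))).congr_deriv (by
      push_cast
      linear_combination (-4 * (B t : ℂ) ^ 2 * Q t) * Complex.I_sq)
  have hn := norm_sq_eq_of_hasDerivWithinAt_mul_I (r := fun t => -2 * B t ^ 2) hd t ht
  have h0 : P 0 - 2 * Complex.I * Q 0 = 0 := by
    rw [h.P_zero, h.Q_zero, mul_comm 2, mul_assoc, ← mul_sub]
    have : (√2 : ℝ) - 2 * (1 / √2) = 0 := by
      rw [mul_one_div, Real.div_sqrt, sub_self]
    have : ((√2 : ℝ) : ℂ) - 2 * ((1 / √2 : ℝ) : ℂ) = 0 := by exact_mod_cast this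
    rw [this, mul_zero]
  simp only [h0, norm_zero] at hn
  exact sub_eq_zero.1 (norm_eq_zero.1 (by nlinarith [norm_nonneg (P t - 2 * Complex.I * Q t)]))

theorem IsHWPParameters.norm_sq_Q {T : ℝ} {B : ℝ → ℝ} {Q P : ℝ → ℂ} (h : IsHWPParameters T B Q P)
    {t : ℝ} (ht : t ∈ Icc 0 T) : ‖Q t‖ ^ 2 = 1 / 2 := by
  have hd : ∀ t ∈ Icc 0 T, HasDerivWithinAt Q
      (((2 * B t ^ 2 : ℝ) : ℂ) * Complex.I * Q t) (Icc 0 T) t :=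
    fun t ht => (h.deriv_Q t ht).congr_deriv (by rw [h.P_eq ht]; push_cast; ring)
  have hn := norm_sq_eq_of_hasDerivWithinAt_mul_I (r := fun t => 2 * B t ^ 2) hd t ht
  rw [hn, h.Q_zero, Complex.norm_real, Real.norm_eq_abs, sq_abs, div_pow, Real.sq_sqrt zero_le_two]
  norm_num

theorem IsHWPParameters.norm_Q {T : ℝ} {B : ℝ → ℝ} {Q P : ℝ → ℂ} (h : IsHWPParameters T B Q P)
    {t : ℝ} (ht : t ∈ Icc 0 T) : ‖Q t‖ = 1 / √2 := by
  rw [← Real.sqrt_sq (norm_nonneg (Q t)), h.norm_sq_Q ht, Real.sqrt_div zero_le_one, Real.sqrt_one]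

/-! ### Hagedorn wave-packets are Hermite functions up to a phase -/

theorem raising_const_mul {Q P : ℂ} (hP : P = 2 * Complex.I * Q) (c : ℂ) (f : 𝓢(ℝ, ℂ)) (x : ℝ) :
    raising Q P (fun y => c * f y) x = ((√2 : ℝ) : ℂ) * conj Q * c * raise f x := by
  have hd : deriv (fun y => c * f y) x = c * deriv f x := ((f.hasDerivAt x).const_mul c).deriv
  have h2 : ((1 / √2 : ℝ) : ℂ) = ((√2 : ℝ) : ℂ) / 2 := by
    rw [← Complex.ofReal_ofNat, ← Complex.ofReal_div, ← Real.sqrt_div_self']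
  rw [raising, hd, hP, raise_apply, h2]
  simp only [map_mul, Complex.conj_I, map_ofNat]
  linear_combination (((√2 : ℝ) : ℂ) / 2 * conj Q * c * deriv f x
    - ((√2 : ℝ) : ℂ) * conj Q * c * x * f x) * Complex.I_sq

/-- The branch of `Q^(-1/2)` and the rotation of `Q` only enter through a phase `c`. -/
theorem exists_phase_hwp {Q P : ℂ} (hP : P = 2 * Complex.I * Q) (hQ : ‖Q‖ = 1 / √2) (k : ℕ) :
    ∃ c : ℂ, ‖c‖ = 1 ∧ hwp Q P k = fun x => c * herm k x := by
  have hQ0 : Q ≠ 0 := by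
    rw [← norm_pos_iff, hQ]; positivity
  induction k with
  | zero =>
    refine ⟨((Real.pi ^ (-(1 / 4) : ℝ) : ℝ) : ℂ) * Q ^ (-(1 / 2) : ℂ) *
      (((2 / Real.pi) ^ (1 / 4 : ℝ) : ℝ) : ℂ)⁻¹, ?_, ?_⟩
    · have h1 : ‖Q ^ (-(1 / 2) : ℂ)‖ = (2 : ℝ) ^ (1 / 4 : ℝ) := by
        have : (-(1 / 2) : ℂ) = ((-(1 / 2) : ℝ) : ℂ) := by push_cast; rfl
        rw [this, Complex.norm_cpow_real, hQ, Real.sqrt_eq_rpow, one_div,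
          ← Real.rpow_neg two_pos.le,
          ← Real.rpow_mul two_pos.le]
        norm_num
      rw [norm_mul, norm_mul, h1, norm_inv, Complex.norm_real, Complex.norm_real,
        Real.norm_of_nonneg (by positivity), Real.norm_of_nonneg (by positivity),
        Real.div_rpow two_pos.le Real.pi_pos.le, Real.rpow_neg Real.pi_pos.le]
      have : (0 : ℝ) < Real.pi ^ (1 / 4 : ℝ) := by positivity
      have : (0 : ℝ) < 2 ^ (1 / 4 : ℝ) := by positivity
      field_simp
    · funext x
      have hc : ((((2 / Real.pi) ^ (1 / 4 : ℝ) : ℝ)) : ℂ) ≠ 0 := by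
        have : (0 : ℝ) < (2 / Real.pi) ^ (1 / 4 : ℝ) := by positivity
        exact_mod_cast this.ne'
      have he : Complex.I / 2 * (P * Q⁻¹) * (x : ℂ) ^ 2 = -(x : ℂ) ^ 2 := by
        rw [hP]
        field_simp
        rw [Complex.I_sq]
        ring
      simp only [hwp]
      rw [herm.eq_1, smul_apply, smul_eq_mul, gaussianSchwartz_apply, he]
      field_simp
  | succ k ih =>
    obtain ⟨c, hc, hk⟩ := ih
    refine ⟨((√2 : ℝ) : ℂ) * conj Q * c, ?_, ?_⟩
    · rw [norm_mul, norm_mul, hc, RCLike.norm_conj, hQ, Complex.norm_real,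
        Real.norm_of_nonneg (by positivity)]
      field_simp
    · funext x
      simp only [hwp, hk]
      rw [raising_const_mul hP c (herm k), herm.eq_2, smul_apply, smul_eq_mul]
      ring

theorem hwpProj_eq {Q P : ℂ} (hP : P = 2 * Complex.I * Q) (hQ : ‖Q‖ = 1 / √2) (N : ℕ)
    (f : ℝ → ℂ) (x : ℝ) :
    hwpProj Q P N f x = ∑ k ∈ Finset.range (N + 1), (∫ y, herm k y * f y) * herm k x := by
  refine Finset.sum_congr rfl fun k _ => ?_
  obtain ⟨c, hc, hk⟩ := exists_phase_hwp hP hQ k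
  have e : ∀ y, conj (hwp Q P k y) * f y = conj c * (herm k y * f y) := fun y => by
    rw [hk, map_mul, conj_herm]; ring
  simp only [e]
  rw [integral_const_mul, hk]
  have : conj c * c = 1 := by rw [RCLike.conj_mul, hc]; simp
  linear_combination ((∫ y, herm k y * f y) * herm k x) * this

theorem mem_span_hwp {Q P : ℂ} (hP : P = 2 * Complex.I * Q) (hQ : ‖Q‖ = 1 / √2) {N : ℕ}
    {f : ℝ → ℂ} (hf : f ∈ Submodule.span ℂ (hwp Q P '' {k | k ≤ N})) :
    f ∈ Submodule.span ℂ ((fun k => (herm k : ℝ → ℂ)) '' {k | k ≤ N}) := by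
  refine Submodule.span_le.2 ?_ hf
  rintro _ ⟨k, hk, rfl⟩
  obtain ⟨c, -, h⟩ := exists_phase_hwp hP hQ k
  rw [h]
  exact Submodule.smul_mem _ c (Submodule.subset_span ⟨k, hk, rfl⟩)

/-! ### The residue potential is cubically bounded -/

theorem integral_deriv_mul_eq_neg {u : ℝ → ℝ} (hu : ContDiff ℝ 1 u) {g : ℝ → ℝ}
    (hg : ContDiff ℝ ∞ g) (hgc : HasCompactSupport g) :
    ∫ x, deriv u x * g x = -∫ x, u x * deriv g x := by
  have hu' : Continuous (deriv u) := hu.continuous_deriv le_rfl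
  have hg' : Continuous (deriv g) := hg.continuous_deriv (by simp)
  have := integral_mul_deriv_eq_deriv_mul_of_integrable (u := u) (v := g) (u' := deriv u)
    (v' := deriv g) (fun x _ => (hu.differentiable one_ne_zero x).hasDerivAt)
    (fun x _ => (hg.differentiable (by simp) x).hasDerivAt)
    ((hu.continuous.mul hg').integrable_of_hasCompactSupport hgc.deriv.mul_left)
    ((hu'.mul hg.continuous).integrable_of_hasCompactSupport hgc.mul_left)
    ((hu.continuous.mul hg.continuous).integrable_of_hasCompactSupport hgc.mul_left)
  rw [this, neg_neg]

theorem IsWeakDeriv.integral_iteratedDeriv_two {V V₃ : ℝ → ℝ} (hV : ContDiff ℝ 2 V)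
    (h : IsWeakDeriv 3 V V₃) {g : ℝ → ℝ} (hg : ContDiff ℝ ∞ g) (hgc : HasCompactSupport g) :
    ∫ x, iteratedDeriv 2 V x * deriv g x = -∫ x, V₃ x * g x := by
  have hg1 : ContDiff ℝ ∞ (deriv g) := (contDiff_infty_iff_deriv.1 hg).2
  have hg2 : ContDiff ℝ ∞ (deriv (deriv g)) := (contDiff_infty_iff_deriv.1 hg1).2
  have h1 : iteratedDeriv 2 V = deriv (deriv V) := by
    rw [iteratedDeriv_succ, iteratedDeriv_one]
  have h2 : iteratedDeriv 3 g = deriv (deriv (deriv g)) := by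
    rw [iteratedDeriv_succ, iteratedDeriv_succ, iteratedDeriv_one]
  have hV1 : ContDiff ℝ 1 (deriv V) := by
    have : ContDiff ℝ (1 + 1) V := by simpa [one_add_one_eq_two] using hV
    exact ((contDiff_succ_iff_deriv (n := 1)).1 this).2.2
  rw [h1, integral_deriv_mul_eq_neg hV1 hg1 hgc.deriv,
    integral_deriv_mul_eq_neg (hV.of_le one_le_two) hg2 hgc.deriv.deriv, neg_neg, ← h2,
    h.2 g hg hgc]
  norm_num

theorem norm_integral_mul_le_of_ae_bound {v g : ℝ → ℝ} {L : ℝ} (hv : ∀ᵐ x, ‖v x‖ ≤ L)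
    (hg : Integrable g) (hg0 : ∀ x, 0 ≤ g x) : ‖∫ x, v x * g x‖ ≤ L * ∫ x, g x := by
  rw [← integral_const_mul]
  refine norm_integral_le_of_norm_le (hg.const_mul L) ?_
  filter_upwards [hv] with x hx
  rw [norm_mul, Real.norm_of_nonneg (hg0 x)]
  exact mul_le_mul_of_nonneg_right hx (hg0 x)

open scoped Convolution Topology in
/-- A continuous function with weak derivative bounded by `L` is `L`-Lipschitz: its mollifications
have derivatives bounded by `L`. -/
theorem abs_sub_le_of_weak_deriv_bound {u v : ℝ → ℝ} (hu : Continuous u) {L : ℝ}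
    (hv : ∀ᵐ x, ‖v x‖ ≤ L)
    (h : ∀ g : ℝ → ℝ, ContDiff ℝ ∞ g → HasCompactSupport g →
      ∫ x, u x * deriv g x = -∫ x, v x * g x) (x y : ℝ) :
    |u y - u x| ≤ L * |y - x| := by
  let κ : ℕ → ContDiffBump (0 : ℝ) := fun n =>
    ⟨1 / ((n : ℝ) + 1), 2 * (1 / ((n : ℝ) + 1)), by positivity, by
      have : 0 < 1 / ((n : ℝ) + 1) := by positivity
      linarith⟩
  have hκ : Filter.Tendsto (fun n => (κ n).rOut) Filter.atTop (𝓝 0) := by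
    have := (tendsto_one_div_add_atTop_nhds_zero_nat (𝕜 := ℝ)).const_mul 2
    rw [mul_zero] at this
    exact this
  let F : ℕ → ℝ → ℝ := fun n => (κ n).normed volume ⋆[ContinuousLinearMap.lsmul ℝ ℝ, volume] u
  have hlim : ∀ z, Filter.Tendsto (fun n => F n z) Filter.atTop (𝓝 (u z)) := fun z =>
    ContDiffBump.convolution_tendsto_right_of_continuous hκ hu z
  have hbound : ∀ n, |F n y - F n x| ≤ L * |y - x| := by
    intro n
    set σ := (κ n).normed volume
    have hσ : ContDiff ℝ ∞ σ := (κ n).contDiff_normed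
    have hσc : HasCompactSupport σ := (κ n).hasCompactSupport_normed
    have hd : ∀ z, HasDerivAt (F n) ((deriv σ ⋆[ContinuousLinearMap.lsmul ℝ ℝ, volume] u) z) z :=
      fun z => hσc.hasDerivAt_convolution_left _ (hσ.of_le (by simp)) hu.locallyIntegrable z
    refine Convex.norm_image_sub_le_of_norm_hasDerivWithin_le (s := univ)
      (fun z _ => (hd z).hasDerivWithinAt) (fun z _ => ?_) convex_univ (mem_univ _) (mem_univ _)
    have hg : ContDiff ℝ ∞ (fun s => σ (z - s)) := hσ.comp (contDiff_const.sub contDiff_id)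
    have hgc : HasCompactSupport (fun s => σ (z - s)) :=
      hσc.comp_homeomorph (Homeomorph.subLeft z)
    have hdg : ∀ s, deriv (fun s => σ (z - s)) s = -deriv σ (z - s) := fun s =>
      deriv_comp_const_sub _ _ _
    have e : (deriv σ ⋆[ContinuousLinearMap.lsmul ℝ ℝ, volume] u) z =
        ∫ s, v s * σ (z - s) := by
      rw [convolution_def, ← neg_neg (∫ s, v s * σ (z - s)), ← h _ hg hgc, ← integral_neg,
        ← integral_sub_left_eq_self _ volume z]
      refine integral_congr_ae (.of_forall fun s => ?_)
      simp [hdg, mul_comm]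
    rw [e]
    have hi : ∫ s, σ (z - s) = 1 := by
      rw [integral_sub_left_eq_self (fun s => σ s) volume z]
      exact (κ n).integral_normed
    have := norm_integral_mul_le_of_ae_bound hv (hg.continuous.integrable_of_hasCompactSupport hgc)
      (fun s => (κ n).nonneg_normed _)
    rwa [hi, mul_one] at this
  refine le_of_tendsto (((hlim y).sub (hlim x)).abs) (.of_forall hbound)

theorem exists_lipschitz_iteratedDeriv_two {V : ℝ → ℝ} (hV : ContDiff ℝ 2 V)
    (hV3 : ∃ V₃ : ℝ → ℝ, MemLp V₃ ⊤ volume ∧ IsWeakDeriv 3 V V₃) :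
    ∃ L : ℝ, 0 ≤ L ∧ ∀ x y, |iteratedDeriv 2 V y - iteratedDeriv 2 V x| ≤ L * |y - x| := by
  obtain ⟨V₃, hmem, hw⟩ := hV3
  refine ⟨(eLpNorm V₃ ⊤ volume).toReal, ENNReal.toReal_nonneg, ?_⟩
  refine abs_sub_le_of_weak_deriv_bound (v := V₃) (hV.continuous_iteratedDeriv' 2) ?_
    fun g hg hgc => hw.integral_iteratedDeriv_two hV hg hgc
  have hfin : eLpNormEssSup V₃ volume ≠ ⊤ := by
    rw [← eLpNorm_exponent_top]; exact hmem.2.ne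
  filter_upwards [ae_le_eLpNormEssSup (f := V₃) (μ := volume)] with x hx
  rw [eLpNorm_exponent_top, ← toReal_enorm]
  exact ENNReal.toReal_mono hfin hx

theorem abs_taylor_two_le {V : ℝ → ℝ} (hV : ContDiff ℝ 2 V) {L : ℝ} (hL : 0 ≤ L)
    (h : ∀ x y, |iteratedDeriv 2 V y - iteratedDeriv 2 V x| ≤ L * |y - x|) (q s : ℝ) :
    |V (q + s) - V q - deriv V q * s - iteratedDeriv 2 V q / 2 * s ^ 2| ≤ L * |s| ^ 3 := by
  have h1 : iteratedDeriv 2 V = deriv (deriv V) := by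
    rw [iteratedDeriv_succ, iteratedDeriv_one]
  have hV1 : ContDiff ℝ 1 (deriv V) := by
    have : ContDiff ℝ (1 + 1) V := by simpa [one_add_one_eq_two] using hV
    exact ((contDiff_succ_iff_deriv (n := 1)).1 this).2.2
  have hs0 : (0 : ℝ) ∈ uIcc 0 s := left_mem_uIcc
  have hs1 : s ∈ uIcc 0 s := right_mem_uIcc
  have habs : ∀ r ∈ uIcc 0 s, |r| ≤ |s| := fun r hr => by
    simpa using abs_sub_left_of_mem_uIcc hr
  have hd1 : ∀ r, HasDerivAt (fun r => deriv V (q + r) - deriv V q - deriv (deriv V) q * r)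
      (deriv (deriv V) (q + r) - deriv (deriv V) q) r := fun r => by
    have := ((hV1.differentiable one_ne_zero (q + r)).hasDerivAt.comp_const_add q r)
    exact ((this.sub_const _).sub ((hasDerivAt_id r).const_mul _)).congr_deriv (by simp)
  have hd0 : ∀ r, HasDerivAt
      (fun r => V (q + r) - V q - deriv V q * r - deriv (deriv V) q / 2 * r ^ 2)
      (deriv V (q + r) - deriv V q - deriv (deriv V) q * r) r := fun r => by
    have := ((hV.differentiable two_ne_zero (q + r)).hasDerivAt.comp_const_add q r)
    exact (((this.sub_const _).sub ((hasDerivAt_id r).const_mul _)).sub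
      ((hasDerivAt_pow 2 r).const_mul _)).congr_deriv (by simp; ring)
  have b1 : ∀ r ∈ uIcc 0 s,
      |deriv V (q + r) - deriv V q - deriv (deriv V) q * r| ≤ L * |s| * |s| := by
    intro r hr
    have := (convex_uIcc 0 s).norm_image_sub_le_of_norm_hasDerivWithin_le
      (fun z _ => (hd1 z).hasDerivWithinAt) (C := L * |s|) (fun z hz => by
        rw [← h1]
        refine (h q (q + z)).trans ?_
        rw [add_sub_cancel_left]
        exact mul_le_mul_of_nonneg_left (habs z hz) hL) hs0 hr
    simp only [add_zero, sub_self, mul_zero, sub_zero, Real.norm_eq_abs] at this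
    exact this.trans (mul_le_mul_of_nonneg_left (habs r hr) (by positivity))
  have := (convex_uIcc 0 s).norm_image_sub_le_of_norm_hasDerivWithin_le
    (fun z _ => (hd0 z).hasDerivWithinAt) (C := L * |s| * |s|) b1 hs0 hs1
  simp only [add_zero, sub_self, mul_zero, sub_zero, Real.norm_eq_abs, ne_eq, OfNat.ofNat_ne_zero,
    not_false_eq_true, zero_pow] at this
  rw [h1]
  exact this.trans_eq (by ring)

theorem abs_residuePotential_le {V : ℝ → ℝ} (hV : ContDiff ℝ 2 V) {L : ℝ} (hL : 0 ≤ L)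
    (h : ∀ x y, |iteratedDeriv 2 V y - iteratedDeriv 2 V x| ≤ L * |y - x|) {ε : ℝ} (hε : 0 < ε)
    (q : ℝ) {B : ℝ} (hB : 0 < B) (η : ℝ) :
    |residuePotential V ε q B η| ≤ L * B⁻¹ ^ 3 * |η| ^ 3 := by
  have hs : √ε ^ 2 = ε := Real.sq_sqrt hε.le
  have h32 : ε ^ (3 / 2 : ℝ) = √ε ^ 3 := by
    rw [Real.sqrt_eq_rpow, ← Real.rpow_natCast, ← Real.rpow_mul hε.le]
    norm_num
  have hpos : 0 < √ε := Real.sqrt_pos.2 hε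
  have ht := abs_taylor_two_le hV hL h q (√ε * (B⁻¹ * η))
  have e : V (q + √ε * (B⁻¹ * η)) - V q - √ε * deriv V q * (B⁻¹ * η)
      - ε / 2 * iteratedDeriv 2 V q * (B⁻¹ * η) ^ 2 = V (q + √ε * (B⁻¹ * η)) - V q -
      deriv V q * (√ε * (B⁻¹ * η)) - iteratedDeriv 2 V q / 2 * (√ε * (B⁻¹ * η)) ^ 2 := by
    rw [mul_pow (√ε), hs]; ring
  rw [residuePotential, e, abs_mul, h32, abs_of_pos (by positivity), one_div_mul_eq_div,
    div_le_iff₀ (by positivity)]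
  refine ht.trans_eq ?_
  rw [abs_mul, abs_mul, abs_of_pos hpos, abs_of_pos (inv_pos.2 hB)]
  ring

theorem continuous_residuePotential {V : ℝ → ℝ} (hV : ContDiff ℝ 2 V) (ε q B : ℝ) :
    Continuous (residuePotential V ε q B) := by
  have := hV.continuous
  unfold residuePotential
  fun_prop

/-! ### Decay of the Hermite coefficients -/

/-- For `P = 2iQ` the lowering operator on distributions is a multiple of the transpose of
`raise`. -/
theorem lowering_apply {Q P : ℂ} (hP : P = 2 * Complex.I * Q) (S : 𝓢'(ℝ, ℂ)) (g : 𝓢(ℝ, ℂ)) :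
    lowering Q P S g = ((√2 : ℝ) : ℂ) * Q * S (raise g) := by
  have h2 : ((1 / √2 : ℝ) : ℂ) = ((√2 : ℝ) : ℂ) / 2 := by
    rw [← Complex.ofReal_ofNat, ← Complex.ofReal_div, ← Real.sqrt_div_self']
  have e : lowering Q P S g = ((1 / √2 : ℝ) : ℂ) * ((Complex.I * Q) *
      (-Complex.I * S (-SchwartzMap.derivCLM ℂ ℂ g)) - Complex.I * P * S (mulX g)) := rfl
  rw [e, h2, hP, map_neg, raise, sub_apply, smul_apply, map_sub, map_smul, smul_eq_mul]
  linear_combination (((√2 : ℝ) : ℂ) / 2 * Q * S (SchwartzMap.derivCLM ℂ ℂ g)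
    - ((√2 : ℝ) : ℂ) * Q * S (mulX g)) * Complex.I_sq

theorem norm_sq_lowering_pow_herm {Q P : ℂ} (hP : P = 2 * Complex.I * Q) (hQ : ‖Q‖ = 1 / √2)
    (S : 𝓢'(ℝ, ℂ)) (m k : ℕ) :
    (k ! : ℝ) * ‖(lowering Q P ^ m) S (herm k)‖ ^ 2 = ((k + m)! : ℝ) * ‖S (herm (k + m))‖ ^ 2 := by
  induction m generalizing k with
  | zero => simp
  | succ m ih =>
    have h1 : ‖((√2 : ℝ) : ℂ) * Q‖ = 1 := by
      rw [norm_mul, hQ, Complex.norm_real, Real.norm_of_nonneg (by positivity)]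
      field_simp
    rw [pow_succ' (lowering Q P), mul_apply_eq_comp, lowering_apply hP, norm_mul, h1,
      one_mul, raise_herm,
      map_smul, norm_smul, mul_pow, Complex.norm_real, Real.norm_eq_abs, sq_abs,
      Real.sq_sqrt (by positivity)]
    have := ih (k + 1)
    rw [show k + (m + 1) = k + 1 + m by ring, ← this, Nat.factorial_succ]
    push_cast
    ring

theorem factorial_mul_factorial_add_le {a b : ℕ} (h : a ≤ b) (m : ℕ) :
    b ! * (a + m)! ≤ a ! * (b + m)! := by
  rw [← Nat.add_choose_mul_factorial_mul_factorial a m,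
    ← Nat.add_choose_mul_factorial_mul_factorial b m]
  have := Nat.choose_le_choose m (Nat.add_le_add_right h m)
  calc b ! * ((a + m).choose m * a ! * m !) = (a + m).choose m * (a ! * b ! * m !) := by ring
    _ ≤ (b + m).choose m * (a ! * b ! * m !) := Nat.mul_le_mul_right _ this
    _ = _ := by ring

/-- The remainder of `f` after projecting onto the first `n` Hermite functions. -/
def hermTail (n : ℕ) (f : Lp ℂ 2 (volume : Measure ℝ)) : Lp ℂ 2 (volume : Measure ℝ) :=
  f - ∑ k ∈ Finset.range n, (inner ℂ (hermLp k) f : ℂ) • hermLp k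

theorem inner_hermLp_hermTail (n k : ℕ) (f : Lp ℂ 2 (volume : Measure ℝ)) :
    inner ℂ (hermLp k) (hermTail n f) = if k < n then 0 else inner ℂ (hermLp k) f := by
  rw [hermTail, inner_sub_right, inner_sum]
  simp only [inner_smul_right, orthonormal_iff_ite.1 orthonormal_hermLp, mul_ite, mul_one, mul_zero,
    Finset.sum_ite_eq, Finset.mem_range]
  split_ifs <;> simp

/-- If `Aᵐ f` lies in `L²`, the projection error of `f` gains the factor `√((n - m)! / n!)`. -/
theorem norm_hermTail_le {Q P : ℂ} (hP : P = 2 * Complex.I * Q) (hQ : ‖Q‖ = 1 / √2) {m n : ℕ}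
    (hmn : m ≤ n) (f g : Lp ℂ 2 (volume : Measure ℝ))
    (h : (lowering Q P ^ m) (Lp.toTemperedDistribution f) = Lp.toTemperedDistribution g) :
    ‖hermTail n f‖ ≤ √(((n - m)! : ℝ) / (n ! : ℝ)) * ‖g‖ := by
  have hcoef : ∀ k, (k ! : ℝ) * ‖inner ℂ (hermLp k) g‖ ^ 2 =
      ((k + m)! : ℝ) * ‖inner ℂ (hermLp (k + m)) f‖ ^ 2 := fun k => by
    have := norm_sq_lowering_pow_herm hP hQ (Lp.toTemperedDistribution f) m k
    rw [h, Lp.toTemperedDistribution_apply, Lp.toTemperedDistribution_apply] at this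
    simpa only [inner_hermLp, smul_eq_mul] using this
  -- The first `n ≥ m` coefficients of the tail vanish, so its Parseval series shifts by `m`.
  have hs := hasSum_sq_norm_inner_hermLp (hermTail n f)
  rw [← hasSum_nat_add_iff' m, Finset.sum_eq_zero (fun i hi => by
    rw [inner_hermLp_hermTail, if_pos ((Finset.mem_range.1 hi).trans_le hmn)]; simp),
    sub_zero] at hs
  have hle : ‖hermTail n f‖ ^ 2 ≤ ((n - m)! : ℝ) / (n ! : ℝ) * ‖g‖ ^ 2 := by
    refine hasSum_le (fun k => ?_) hs ((hasSum_sq_norm_inner_hermLp g).mul_left _)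
    rw [inner_hermLp_hermTail]
    split_ifs with hk
    · rw [norm_zero, zero_pow two_ne_zero]; positivity
    · have h1 := factorial_mul_factorial_add_le (show n - m ≤ k by omega) m
      rw [Nat.sub_add_cancel hmn] at h1
      have h2 : (k ! : ℝ) * n ! ≤ (n - m)! * (k + m)! := by exact_mod_cast h1
      have h3 : (0 : ℝ) < (k + m)! := by positivity
      rw [div_mul_eq_mul_div, le_div_iff₀ (by positivity)]
      refine le_of_mul_le_mul_left ?_ (by positivity : (0 : ℝ) < (k ! : ℝ))
      calc (k ! : ℝ) * (‖inner ℂ (hermLp (k + m)) f‖ ^ 2 * n !)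
          = (k ! * n !) * ‖inner ℂ (hermLp (k + m)) f‖ ^ 2 := by ring
        _ ≤ ((n - m)! * (k + m)!) * ‖inner ℂ (hermLp (k + m)) f‖ ^ 2 :=
          mul_le_mul_of_nonneg_right h2 (by positivity)
        _ = (n - m)! * (k ! * ‖inner ℂ (hermLp k) g‖ ^ 2) := by rw [hcoef]; ring
        _ = _ := by ring
  calc ‖hermTail n f‖ = √(‖hermTail n f‖ ^ 2) := (Real.sqrt_sq (norm_nonneg _)).symm
    _ ≤ √(((n - m)! : ℝ) / (n ! : ℝ) * ‖g‖ ^ 2) := Real.sqrt_le_sqrt hle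
    _ = _ := by rw [Real.sqrt_mul (by positivity), Real.sqrt_sq (norm_nonneg _)]

/-! ### Finite Hermite expansions -/

/-- The Hermite expansion with coefficients `a 0, …, a (n - 1)`. -/
def hermComb (n : ℕ) (a : ℕ → ℂ) : 𝓢(ℝ, ℂ) := ∑ k ∈ Finset.range n, a k • herm k

theorem hermComb_apply (n : ℕ) (a : ℕ → ℂ) (x : ℝ) :
    hermComb n a x = ∑ k ∈ Finset.range n, a k * herm k x := by
  rw [hermComb, sum_apply]
  rfl

theorem toLp_hermComb (n : ℕ) (a : ℕ → ℂ) :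
    (hermComb n a).toLp 2 = ∑ k ∈ Finset.range n, a k • hermLp k := by
  have := map_sum (SchwartzMap.toLpCLM ℂ ℂ 2 (volume : Measure ℝ)) (fun k => a k • herm k)
    (Finset.range n)
  simp only [map_smul, SchwartzMap.toLpCLM_apply] at this
  exact this

theorem norm_sq_toLp_hermComb (n : ℕ) (a : ℕ → ℂ) :
    ‖(hermComb n a).toLp 2 (volume : Measure ℝ)‖ ^ 2 = ∑ k ∈ Finset.range n, ‖a k‖ ^ 2 := by
  rw [toLp_hermComb, ← inner_self_eq_norm_sq (𝕜 := ℂ), orthonormal_hermLp.inner_sum, map_sum]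
  refine Finset.sum_congr rfl fun k _ => ?_
  rw [RCLike.conj_mul]
  norm_cast

theorem raise_hermComb (n : ℕ) (a : ℕ → ℂ) :
    raise (hermComb n a) = ∑ k ∈ Finset.range n, (a k * (√((k : ℝ) + 1) : ℝ)) • herm (k + 1) := by
  simp only [hermComb, map_sum, map_smul, raise_herm, smul_smul]

theorem raise_hermComb_eq (n : ℕ) (a : ℕ → ℂ) :
    raise (hermComb n a) = hermComb (n + 1) (fun k => a (k - 1) * (√(k : ℝ) : ℝ)) := by
  rw [raise_hermComb, hermComb, Finset.sum_range_succ']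
  simp

theorem lower_hermComb_eq (n : ℕ) (a : ℕ → ℂ) :
    lower (hermComb (n + 1) a) = hermComb n (fun k => a (k + 1) * (√((k : ℝ) + 1) : ℝ)) := by
  simp only [hermComb]
  rw [Finset.sum_range_succ']
  simp only [map_add, map_sum, map_smul, lower_herm_succ, lower_herm_zero, smul_smul, smul_zero,
    add_zero]

theorem norm_toLp_raise_hermComb_le (n : ℕ) (a : ℕ → ℂ) :
    ‖(raise (hermComb n a)).toLp 2 (volume : Measure ℝ)‖ ≤
      √n * ‖(hermComb n a).toLp 2 (volume : Measure ℝ)‖ := by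
  refine le_of_sq_le_sq ?_ (by positivity)
  rw [raise_hermComb_eq, mul_pow, norm_sq_toLp_hermComb, norm_sq_toLp_hermComb,
    Real.sq_sqrt (by positivity), Finset.sum_range_succ', Finset.mul_sum]
  simp only [norm_mul, mul_pow, Complex.norm_real, Real.norm_eq_abs, sq_abs]
  simp only [CharP.cast_eq_zero, Real.sqrt_zero, ne_eq, OfNat.ofNat_ne_zero, not_false_eq_true,
    zero_pow, mul_zero, add_zero]
  refine Finset.sum_le_sum fun k hk => ?_
  rw [Real.sq_sqrt (by positivity), Nat.add_sub_cancel, mul_comm]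
  refine mul_le_mul_of_nonneg_right ?_ (by positivity)
  exact_mod_cast Finset.mem_range.1 hk

theorem norm_toLp_lower_hermComb_le (n : ℕ) (a : ℕ → ℂ) :
    ‖(lower (hermComb (n + 1) a)).toLp 2 (volume : Measure ℝ)‖ ≤
      √((n + 1 : ℕ) : ℝ) * ‖(hermComb (n + 1) a).toLp 2 (volume : Measure ℝ)‖ := by
  refine le_of_sq_le_sq ?_ (by positivity)
  rw [lower_hermComb_eq, mul_pow, norm_sq_toLp_hermComb, norm_sq_toLp_hermComb,
    Real.sq_sqrt (by positivity), Finset.sum_range_succ', mul_add, Finset.mul_sum]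
  simp only [norm_mul, mul_pow, Complex.norm_real, Real.norm_eq_abs, sq_abs]
  refine le_add_of_le_of_nonneg ?_ (by positivity)
  refine Finset.sum_le_sum fun k hk => ?_
  rw [Real.sq_sqrt (by positivity), mul_comm]
  refine mul_le_mul_of_nonneg_right ?_ (by positivity)
  exact_mod_cast (Nat.succ_le_succ (Finset.mem_range.1 hk).le)

theorem exists_mulX_hermComb_eq (n : ℕ) (a : ℕ → ℂ) :
    ∃ b, mulX (hermComb (n + 1) a) = hermComb (n + 2) b := by
  refine ⟨fun k => (1 / 2 : ℂ) * (a (k - 1) * (√(k : ℝ) : ℝ) +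
    if k < n then a (k + 1) * (√((k : ℝ) + 1) : ℝ) else 0), ?_⟩
  have : hermComb n (fun k => a (k + 1) * (√((k : ℝ) + 1) : ℝ)) =
      hermComb (n + 2) (fun k => if k < n then a (k + 1) * (√((k : ℝ) + 1) : ℝ) else 0) := by
    simp [hermComb, Finset.sum_range_succ, Finset.sum_ite_of_true]
  rw [mulX_eq, raise_hermComb_eq, lower_hermComb_eq, this]
  simp only [hermComb, ← Finset.sum_add_distrib, Finset.smul_sum, ← add_smul, smul_smul]

theorem norm_toLp_mulX_hermComb_le (n : ℕ) (a : ℕ → ℂ) :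
    ‖(mulX (hermComb (n + 1) a)).toLp 2 (volume : Measure ℝ)‖ ≤
      √((n + 1 : ℕ) : ℝ) * ‖(hermComb (n + 1) a).toLp 2 (volume : Measure ℝ)‖ := by
  have h1 := norm_toLp_raise_hermComb_le (n + 1) a
  have h2 := norm_toLp_lower_hermComb_le n a
  rw [mulX_eq]
  have e : ((1 / 2 : ℂ) • (raise (hermComb (n + 1) a) + lower (hermComb (n + 1) a))).toLp 2
      (volume : Measure ℝ) =
      (1 / 2 : ℂ) • ((raise (hermComb (n + 1) a)).toLp 2 (volume : Measure ℝ) +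
        (lower (hermComb (n + 1) a)).toLp 2 (volume : Measure ℝ)) := by
    simp only [← SchwartzMap.toLpCLM_apply (𝕜 := ℂ), map_smul, map_add]
  rw [e, norm_smul]
  have h3 := norm_add_le ((raise (hermComb (n + 1) a)).toLp 2 (volume : Measure ℝ))
    ((lower (hermComb (n + 1) a)).toLp 2)
  have h4 : ‖(1 / 2 : ℂ)‖ = 1 / 2 := by norm_num
  rw [h4]
  linarith

/-- Multiplication by `x³` costs a factor of order `N^(3/2)` on the span of the first `N + 1`
Hermite functions. -/
theorem norm_toLp_mulX_pow_three_le {N : ℕ} (hN : 2 ≤ N) (a : ℕ → ℂ) :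
    ‖((mulX ^ 3) (hermComb (N + 1) a)).toLp 2 (volume : Measure ℝ)‖ ≤
      √10 * √(((N + 1)! : ℝ) / ((N - 2)! : ℝ)) *
        ‖(hermComb (N + 1) a).toLp 2 (volume : Measure ℝ)‖ := by
  obtain ⟨b, hb⟩ := exists_mulX_hermComb_eq N a
  obtain ⟨c, hc⟩ := exists_mulX_hermComb_eq (N + 1) b
  have e : (mulX ^ 3) (hermComb (N + 1) a) = mulX (hermComb (N + 1 + 2) c) := by
    rw [← hc, ← hb]; rfl
  have h1 := norm_toLp_mulX_hermComb_le N a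
  have h2 := norm_toLp_mulX_hermComb_le (N + 1) b
  have h3 := norm_toLp_mulX_hermComb_le (N + 2) c
  rw [hb] at h1
  rw [hc] at h2
  rw [e]
  have hfac : ((N + 1)! : ℝ) / ((N - 2)! : ℝ) = (N + 1) * N * (N - 1) := by
    obtain ⟨M, rfl⟩ := Nat.exists_eq_add_of_le' hN
    rw [Nat.add_sub_cancel, show M + 2 + 1 = (M + 2) + 1 by rfl, Nat.factorial_succ,
      Nat.factorial_succ, Nat.factorial_succ, div_eq_iff (by positivity)]
    push_cast
    ring
  have hN' : (2 : ℝ) ≤ N := by exact_mod_cast hN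
  set X := ‖(hermComb (N + 1) a).toLp 2 (volume : Measure ℝ)‖
  calc _ ≤ √((N + 2 + 1 : ℕ) : ℝ) * (√((N + 1 + 1 : ℕ) : ℝ) * (√((N + 1 : ℕ) : ℝ) * X)) :=
        h3.trans (mul_le_mul_of_nonneg_left (h2.trans
          (mul_le_mul_of_nonneg_left h1 (by positivity))) (by positivity))
    _ = √(((N + 3) * (N + 2) * (N + 1) : ℝ)) * X := by
        rw [Real.sqrt_mul (by positivity), Real.sqrt_mul (by positivity)]
        push_cast
        ring_nf
    _ ≤ √(10 * (((N + 1)! : ℝ) / ((N - 2)! : ℝ))) * X := by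
        refine mul_le_mul_of_nonneg_right (Real.sqrt_le_sqrt ?_) (norm_nonneg _)
        rw [hfac]
        -- `10 N (N - 1) - (N + 2) (N + 3) = (N - 2) (9 N + 3)`, with equality at `N = 2`.
        nlinarith [mul_nonneg (show (0 : ℝ) ≤ N + 1 by linarith)
          (mul_nonneg (show (0 : ℝ) ≤ N - 2 by linarith) (show (0 : ℝ) ≤ 9 * N + 3 by linarith))]
    _ = _ := by rw [Real.sqrt_mul (by norm_num)]

/-! ### Multiplication by a cubically bounded potential -/

theorem memLp_potential_mul {W : ℝ → ℝ} {K : ℝ} (hc : Continuous W)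
    (hb : ∀ x, |W x| ≤ K * |x| ^ 3) (g : 𝓢(ℝ, ℂ)) :
    MemLp (fun x => (W x : ℂ) * g x) 2 volume := by
  refine MemLp.of_le_mul (c := K) (((mulX ^ 3) g).memLp 2 volume)
    ((Complex.continuous_ofReal.comp hc).mul g.continuous).aestronglyMeasurable
    (.of_forall fun x => ?_)
  rw [mulX_pow_apply, norm_mul, norm_mul, norm_pow, Complex.norm_real, Complex.norm_real,
    Real.norm_eq_abs, Real.norm_eq_abs, ← mul_assoc]
  exact mul_le_mul_of_nonneg_right (hb x) (norm_nonneg _)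

/-- Multiplication by a real potential `W` of at most cubic growth, as a map from Schwartz functions
to `L²`. -/
def potentialMul {W : ℝ → ℝ} {K : ℝ} (hc : Continuous W) (hb : ∀ x, |W x| ≤ K * |x| ^ 3) :
    𝓢(ℝ, ℂ) →ₗ[ℂ] Lp ℂ 2 (volume : Measure ℝ) where
  toFun g := (memLp_potential_mul hc hb g).toLp
  map_add' f g := by
    rw [← MemLp.toLp_add]
    congr 1
    funext x
    simp [mul_add]
  map_smul' c g := by
    rw [RingHom.id_apply, ← MemLp.toLp_const_smul]
    congr 1
    funext x
    simp [mul_left_comm]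

section potentialMul

variable {W : ℝ → ℝ} {K : ℝ} (hc : Continuous W) (hb : ∀ x, |W x| ≤ K * |x| ^ 3)

theorem coeFn_potentialMul (g : 𝓢(ℝ, ℂ)) :
    potentialMul hc hb g =ᵐ[volume] fun x => (W x : ℂ) * g x :=
  (memLp_potential_mul hc hb g).coeFn_toLp

theorem norm_potentialMul_le (g : 𝓢(ℝ, ℂ)) :
    ‖potentialMul hc hb g‖ ≤ K * ‖((mulX ^ 3) g).toLp 2 (volume : Measure ℝ)‖ := by
  refine Lp.norm_le_mul_norm_of_ae_le_mul ?_
  filter_upwards [coeFn_potentialMul hc hb g, ((mulX ^ 3) g).coeFn_toLp 2 volume] with x h1 h2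
  rw [h1, h2, mulX_pow_apply, norm_mul, norm_mul, norm_pow, Complex.norm_real, Complex.norm_real,
    Real.norm_eq_abs, Real.norm_eq_abs, ← mul_assoc]
  exact mul_le_mul_of_nonneg_right (hb x) (norm_nonneg _)

theorem inner_potentialMul_comm (f g : 𝓢(ℝ, ℂ)) :
    inner ℂ (f.toLp 2 (volume : Measure ℝ)) (potentialMul hc hb g) =
      inner ℂ (potentialMul hc hb f) (g.toLp 2 (volume : Measure ℝ)) := by
  rw [L2.inner_def, L2.inner_def]
  refine integral_congr_ae ?_
  filter_upwards [coeFn_potentialMul hc hb f, coeFn_potentialMul hc hb g,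
    f.coeFn_toLp 2 volume, g.coeFn_toLp 2 volume] with x h1 h2 h3 h4
  rw [h1, h2, h3, h4]
  simp only [RCLike.inner_apply, map_mul, Complex.conj_ofReal]
  ring

theorem im_inner_potentialMul_self (f : 𝓢(ℝ, ℂ)) :
    (inner ℂ (potentialMul hc hb f) (f.toLp 2 (volume : Measure ℝ)) : ℂ).im = 0 := by
  rw [← Complex.conj_eq_iff_im, inner_conj_symm, inner_potentialMul_comm]

end potentialMul

/-! ### The Hamiltonian on Hermite functions -/

/-- The potential term `√ε U` of the Hamiltonian. -/
def scaledResidue (V : ℝ → ℝ) (ε q B : ℝ) : ℝ → ℝ := fun η => √ε * residuePotential V ε q B η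

theorem hamiltonian_schwartz (V : ℝ → ℝ) (ε q B : ℝ) (g : 𝓢(ℝ, ℂ)) (η : ℝ) :
    hamiltonian V ε q B g η = (B : ℂ) ^ 2 * (2 * raise (lower g) η + g η) +
      (scaledResidue V ε q B η : ℂ) * g η := by
  rw [← oscillator_eq, hamiltonian, scaledResidue]
  ring

/-- The eigenvalue `B² (2k + 1)` of the oscillator `-½ B² ∂² + 2 B² η²` on the `k`-th Hermite
function. -/
def oscEnergy (B : ℝ) (k : ℕ) : ℝ := B ^ 2 * (2 * k + 1)

/-- The oscillator part of the Hamiltonian acts diagonally on Hermite expansions. -/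
theorem hamiltonian_hermComb (V : ℝ → ℝ) (ε q B : ℝ) (n : ℕ) (a : ℕ → ℂ) (η : ℝ) :
    hamiltonian V ε q B (hermComb n a) η = hermComb n (fun k => oscEnergy B k * a k) η +
      (scaledResidue V ε q B η : ℂ) * hermComb n a η := by
  rw [hamiltonian_schwartz]
  congr 1
  have : raise (lower (hermComb n a)) = hermComb n (fun k => k * a k) := by
    simp only [hermComb, map_sum, map_smul, raise_lower_herm, smul_smul, mul_comm]
  rw [this]
  simp only [hermComb_apply, Finset.mul_sum, ← Finset.sum_add_distrib, oscEnergy]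
  refine Finset.sum_congr rfl fun k _ => ?_
  push_cast
  ring

theorem hamiltonian_herm (V : ℝ → ℝ) (ε q B : ℝ) (k : ℕ) (η : ℝ) :
    hamiltonian V ε q B (herm k) η = oscEnergy B k * herm k η +
      (scaledResidue V ε q B η : ℂ) * herm k η := by
  rw [hamiltonian_schwartz, raise_lower_herm, smul_apply, smul_eq_mul, oscEnergy]
  push_cast
  ring

section

variable {V : ℝ → ℝ} {ε q B K : ℝ} (hc : Continuous (scaledResidue V ε q B))
  (hb : ∀ x, |scaledResidue V ε q B x| ≤ K * |x| ^ 3)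

theorem integral_conj_hamiltonian_herm_mul (k : ℕ) (f : Lp ℂ 2 (volume : Measure ℝ)) :
    ∫ η, conj (hamiltonian V ε q B (herm k) η) * f η =
      oscEnergy B k * inner ℂ (hermLp k) f + inner ℂ (potentialMul hc hb (herm k)) f := by
  have e : (oscEnergy B k : ℂ) * inner ℂ (hermLp k) f + inner ℂ (potentialMul hc hb (herm k)) f =
      inner ℂ ((oscEnergy B k : ℂ) • hermLp k + potentialMul hc hb (herm k)) f := by
    rw [inner_add_left, inner_smul_left, Complex.conj_ofReal]
  rw [e, L2.inner_def]
  refine integral_congr_ae ?_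
  filter_upwards [Lp.coeFn_add ((oscEnergy B k : ℂ) • hermLp k) (potentialMul hc hb (herm k)),
    Lp.coeFn_smul (oscEnergy B k : ℂ) (hermLp k), coeFn_potentialMul hc hb (herm k),
    (herm k).coeFn_toLp 2 volume] with x h1 h2 h3 h4
  rw [hamiltonian_herm, h1, Pi.add_apply, h2, Pi.smul_apply, h3, hermLp, h4, RCLike.inner_apply,
    smul_eq_mul, mul_comm]

/-- The matrix elements of the Hamiltonian on a finite expansion, with the potential moved to the
test function. -/
theorem integral_herm_mul_hamiltonian_hermComb {n k : ℕ} (hk : k < n) (a : ℕ → ℂ) :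
    ∫ η, herm k η * hamiltonian V ε q B (hermComb n a) η =
      oscEnergy B k * a k +
        inner ℂ (potentialMul hc hb (herm k)) ((hermComb n a).toLp 2 (volume : Measure ℝ)) := by
  have e : (oscEnergy B k : ℂ) * a k = inner ℂ (hermLp k)
      ((hermComb n (fun k => oscEnergy B k * a k)).toLp 2 (volume : Measure ℝ)) := by
    rw [toLp_hermComb, orthonormal_hermLp.inner_right_sum _ (Finset.mem_range.2 hk)]
  rw [e, ← inner_potentialMul_comm, ← hermLp, ← inner_add_right, inner_hermLp]
  refine integral_congr_ae ?_
  filter_upwards [Lp.coeFn_add ((hermComb n (fun k => oscEnergy B k * a k)).toLp 2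
      (volume : Measure ℝ)) (potentialMul hc hb (hermComb n a)),
    (hermComb n (fun k => oscEnergy B k * a k)).coeFn_toLp 2 volume,
    coeFn_potentialMul hc hb (hermComb n a)] with x h1 h2 h3
  rw [hamiltonian_hermComb, h1, Pi.add_apply, h2, h3]

end

/-! ### Coefficients of the Galerkin solution -/

theorem exists_hermComb_of_mem_span {N : ℕ} {f : ℝ → ℂ}
    (hf : f ∈ Submodule.span ℂ ((fun k => (herm k : ℝ → ℂ)) '' {k | k ≤ N})) :
    ∃ a, f = hermComb (N + 1) a := by
  induction hf using Submodule.span_induction with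
  | mem x hx =>
    obtain ⟨k, hk, rfl⟩ := hx
    refine ⟨fun j => if j = k then 1 else 0, ?_⟩
    funext x
    have : k < N + 1 := Nat.lt_succ_of_le hk
    simp [hermComb_apply, this]
  | zero => exact ⟨0, by funext x; simp [hermComb_apply]⟩
  | add x y _ _ hx hy =>
    obtain ⟨a, rfl⟩ := hx
    obtain ⟨b, rfl⟩ := hy
    refine ⟨a + b, ?_⟩
    funext x
    simp [hermComb_apply, add_mul, Finset.sum_add_distrib]
  | smul c x _ hx =>
    obtain ⟨a, rfl⟩ := hx
    refine ⟨c • a, ?_⟩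
    funext x
    simp [hermComb_apply, Finset.mul_sum, mul_assoc]

theorem eq_zero_of_hermComb_eq_zero {n : ℕ} {a : ℕ → ℂ} (h : ∀ x, hermComb n a x = 0) {k : ℕ}
    (hk : k < n) : a k = 0 := by
  have h0 : hermComb n a = 0 := by ext x; exact h x
  have := norm_sq_toLp_hermComb n a
  rw [h0, ← SchwartzMap.toLpCLM_apply (𝕜 := ℂ), map_zero, norm_zero, zero_pow two_ne_zero, eq_comm,
    Finset.sum_eq_zero_iff_of_nonneg (fun _ _ => by positivity)] at this
  simpa using this k (Finset.mem_range.2 hk)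

/-- A Hermite coefficient of a finite expansion is a linear combination of finitely many point
values. This turns the pointwise Galerkin equation into an equation for the coefficients. -/
theorem exists_coeff_eq_sum_eval {n k : ℕ} (hk : k < n) :
    ∃ (s : Finset ℝ) (μ : ℝ → ℂ), ∀ a, ∑ x ∈ s, μ x * hermComb n a x = a k := by
  let v : ℝ → Fin n → ℂ := fun x j => herm j x
  have htop : Submodule.span ℂ (range v) = ⊤ := by
    by_contra hne
    obtain ⟨f, hf0, hf⟩ := Submodule.exists_le_ker_of_lt_top _ (lt_top_iff_ne_top.2 hne)
    refine hf0 (LinearMap.pi_ext' fun j => LinearMap.ext_ring ?_)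
    let b : ℕ → ℂ := fun i => if h : i < n then f (Pi.single ⟨i, h⟩ 1) else 0
    have hb : ∀ i : Fin n, b i = f (Pi.single i 1) := fun i => by simp [b]
    have : ∀ x, hermComb n b x = 0 := fun x => by
      have h1 : f (v x) = 0 := hf (Submodule.subset_span ⟨x, rfl⟩)
      rw [f.pi_apply_eq_sum_univ] at h1
      rw [hermComb_apply, Finset.sum_range, ← h1]
      refine Finset.sum_congr rfl fun i _ => ?_
      rw [hb, smul_eq_mul, mul_comm]
      congr 2
      funext j
      simp [Pi.single_apply, eq_comm]
    have := eq_zero_of_hermComb_eq_zero this j.2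
    rw [hb] at this
    simpa using this
  have hmem : (Pi.single ⟨k, hk⟩ 1 : Fin n → ℂ) ∈ Submodule.span ℂ (range v) := by
    rw [htop]; trivial
  obtain ⟨c, hc⟩ := Finsupp.mem_span_range_iff_exists_finsupp.1 hmem
  refine ⟨c.support, c, fun a => ?_⟩
  have hcj : ∀ j : Fin n, ∑ x ∈ c.support, c x * herm j x = if j = ⟨k, hk⟩ then 1 else 0 :=
    fun j => by
      have := congrFun hc j
      rw [Finsupp.sum, Finset.sum_apply, Pi.single_apply] at this
      exact this
  simp only [hermComb_apply, Finset.sum_range, Finset.mul_sum]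
  rw [Finset.sum_comm]
  have : ∀ j : Fin n, ∑ x ∈ c.support, c x * (a j * herm j x) =
      if j = ⟨k, hk⟩ then a j else 0 := fun j => by
    have e : ∀ x, c x * (a j * herm j x) = a j * (c x * herm j x) := fun x => by ring
    simp only [e]
    rw [← Finset.mul_sum, hcj]
    simp
  simp only [this]
  simp

theorem hasDerivWithinAt_coeff {n k : ℕ} (hk : k < n) {s : Set ℝ} {t : ℝ} {d : ℝ → ℕ → ℂ}
    {d' : ℕ → ℂ} {f : ℝ → ℝ → ℂ} (hf : ∀ r ∈ s, f r = hermComb n (d r)) (ht : t ∈ s)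
    (h : ∀ x, HasDerivWithinAt (fun r => f r x) (hermComb n d' x) s t) :
    HasDerivWithinAt (fun r => d r k) (d' k) s t := by
  obtain ⟨S, μ, hμ⟩ := exists_coeff_eq_sum_eval hk
  have := HasDerivWithinAt.fun_sum (u := S) (A := fun x r => μ x * f r x)
    (A' := fun x => μ x * hermComb n d' x) fun x _ => (h x).const_mul (μ x)
  rw [hμ] at this
  refine this.congr (fun r hr => ?_) ?_
  · simp only [hf r hr, hμ]
  · simp only [hf t ht, hμ]

/-! ### The energy estimate -/

/-- If `R ≥ 0` vanishes initially and `R' ≤ 2 C √R`, then `√R` grows at most linearly. -/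
theorem sqrt_le_mul_of_deriv_le {T C : ℝ} {R R' : ℝ → ℝ} (hR : ∀ t, 0 ≤ R t) (h0 : R 0 = 0)
    (hC : 0 ≤ C) (hd : ∀ t ∈ Icc 0 T, HasDerivWithinAt R (R' t) (Icc 0 T) t)
    (hle : ∀ t ∈ Icc 0 T, R' t ≤ 2 * (C * √(R t))) : ∀ t ∈ Icc 0 T, √(R t) ≤ C * t := by
  intro t ht
  -- The square root is regularised by `δ²` because it is not differentiable at zero.
  refine le_of_forall_pos_le_add fun δ hδ => ?_
  have hpos : ∀ s, 0 < R s + δ ^ 2 := fun s => by have := hR s; positivity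
  have hder : ∀ s ∈ Icc 0 T, HasDerivWithinAt (fun s => √(R s + δ ^ 2))
      (R' s / (2 * √(R s + δ ^ 2))) (Icc 0 T) s := fun s hs =>
    ((hd s hs).add_const _).sqrt (hpos s).ne'
  have key := image_le_of_deriv_right_le_deriv_boundary (a := 0) (b := T)
    (f := fun s => √(R s + δ ^ 2)) (f' := fun s => R' s / (2 * √(R s + δ ^ 2)))
    (fun s hs => (hder s hs).continuousWithinAt)
    (fun s hs => (hder s ⟨hs.1, hs.2.le⟩).mono_of_mem_nhdsWithin (Icc_mem_nhdsGE_of_mem hs))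
    (B := fun s => C * s + δ) (B' := fun _ => C)
    (by simp [h0, Real.sqrt_sq hδ.le])
    (by fun_prop)
    (fun s _ => by
      simpa using (((hasDerivAt_id s).const_mul C).add_const δ).hasDerivWithinAt)
    (fun s hs => by
      have h1 : √(R s) ≤ √(R s + δ ^ 2) := Real.sqrt_le_sqrt (by nlinarith)
      have h2 := hle s ⟨hs.1, hs.2.le⟩
      have h3 := Real.sqrt_pos.2 (hpos s)
      rw [div_le_iff₀ (by positivity)]
      nlinarith [mul_le_mul_of_nonneg_left h1 hC]) ht
  exact (Real.sqrt_le_sqrt (by nlinarith [sq_nonneg δ])).trans key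

/-- The differential inequality for the Galerkin error: in the derivative of `∑ ‖rₖ‖²` the Hermitian
part of the Hamiltonian drops out and only its action on the tail `ρ` survives. -/
theorem two_mul_sum_re_le {W : ℝ → ℝ} {K : ℝ} (hc : Continuous W) (hb : ∀ x, |W x| ≤ K * |x| ^ 3)
    (n : ℕ) (E : ℕ → ℝ) (r : ℕ → ℂ) (ρ : Lp ℂ 2 (volume : Measure ℝ)) :
    ∑ k ∈ Finset.range n, 2 * inner ℝ (r k) (-Complex.I * (E k * r k +
      inner ℂ (potentialMul hc hb (herm k)) (ρ + (hermComb n r).toLp 2 (volume : Measure ℝ)))) ≤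
      2 * (‖potentialMul hc hb (hermComb n r)‖ * ‖ρ‖) := by
  set f := hermComb n r
  set Mf := potentialMul hc hb f
  have hM : Mf = ∑ k ∈ Finset.range n, r k • potentialMul hc hb (herm k) := by
    simp only [Mf, f, hermComb, map_sum, map_smul]
  have hsum : ∑ k ∈ Finset.range n, conj (r k) * inner ℂ (potentialMul hc hb (herm k))
      (ρ + f.toLp 2 (volume : Measure ℝ)) =
      inner ℂ Mf ρ + inner ℂ Mf (f.toLp 2 (volume : Measure ℝ)) := by
    rw [← inner_add_right, hM, sum_inner]
    simp only [inner_smul_left]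
  have e : ∀ k, inner ℝ (r k) (-Complex.I * (E k * r k +
      inner ℂ (potentialMul hc hb (herm k)) (ρ + f.toLp 2 (volume : Measure ℝ)))) =
      (conj (r k) * inner ℂ (potentialMul hc hb (herm k))
        (ρ + f.toLp 2 (volume : Measure ℝ))).im := fun k => by
    rw [Complex.inner]
    simp only [Complex.mul_re, Complex.mul_im, Complex.add_re, Complex.add_im, Complex.neg_re,
      Complex.neg_im, Complex.I_re, Complex.I_im, Complex.conj_re, Complex.conj_im,
      Complex.ofReal_re, Complex.ofReal_im]
    ring
  simp only [e]
  rw [← Finset.mul_sum, ← Complex.im_sum, hsum, Complex.add_im, im_inner_potentialMul_self,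
    add_zero]
  exact mul_le_mul_of_nonneg_left ((Complex.im_le_norm _).trans (norm_inner_le_norm _ _)) two_pos.le

theorem sub_toLp_hermComb_eq (n : ℕ) (f : Lp ℂ 2 (volume : Measure ℝ)) (d : ℕ → ℂ) :
    f - (hermComb n d).toLp 2 (volume : Measure ℝ) = hermTail n f +
      (hermComb n (fun k => inner ℂ (hermLp k) f - d k)).toLp 2 (volume : Measure ℝ) := by
  simp only [toLp_hermComb, hermTail, sub_smul, Finset.sum_sub_distrib]
  abel

/-! ### The Galerkin error -/

section

variable {V : ℝ → ℝ} {T ε : ℝ} {q B : ℝ → ℝ} {Q P : ℝ → ℂ}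
  {w : ℝ → Lp ℂ 2 (volume : Measure ℝ)} {t : ℝ}

theorem IsWSolution.hasDerivWithinAt_inner_hermLp (hw : IsWSolution V ε T q B w) {K : ℝ}
    (ht : t ∈ Icc 0 T) (hc : Continuous (scaledResidue V ε (q t) (B t)))
    (hb : ∀ x, |scaledResidue V ε (q t) (B t) x| ≤ K * |x| ^ 3) (k : ℕ) :
    HasDerivWithinAt (fun s => (inner ℂ (hermLp k) (w s) : ℂ))
      (-Complex.I * (oscEnergy (B t) k * inner ℂ (hermLp k) (w t) +
        inner ℂ (potentialMul hc hb (herm k)) (w t))) (Icc 0 T) t := by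
  rw [← integral_conj_hamiltonian_herm_mul]
  simp only [hermLp, inner_schwartz_toLp]
  exact hw.weak_eq (herm k) t ht

theorem IsGalerkinSolution.hasDerivWithinAt_coeff {N : ℕ} {w₀ : ℝ → ℂ} {wN : ℝ → ℝ → ℂ}
    (hN : IsGalerkinSolution V ε T q B Q P N w₀ wN) (hh : IsHWPParameters T B Q P)
    {d : ℝ → ℕ → ℂ} (hd : ∀ s ∈ Icc 0 T, wN s = hermComb (N + 1) (d s)) {K : ℝ}
    (ht : t ∈ Icc 0 T) (hc : Continuous (scaledResidue V ε (q t) (B t)))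
    (hb : ∀ x, |scaledResidue V ε (q t) (B t) x| ≤ K * |x| ^ 3) {k : ℕ} (hk : k < N + 1) :
    HasDerivWithinAt (fun s => d s k)
      (-Complex.I * (oscEnergy (B t) k * d t k + inner ℂ (potentialMul hc hb (herm k))
        ((hermComb (N + 1) (d t)).toLp 2 (volume : Measure ℝ)))) (Icc 0 T) t := by
  rw [← integral_herm_mul_hamiltonian_hermComb hc hb hk]
  refine _root_.hasDerivWithinAt_coeff hk hd ht (d' := fun k => -Complex.I *
    ∫ η, herm k η * hamiltonian V ε (q t) (B t) (hermComb (N + 1) (d t)) η) fun x => ?_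
  refine (hN.galerkin_eq t ht x).congr_deriv ?_
  rw [hwpProj_eq (hh.P_eq ht) (hh.norm_Q ht), hermComb_apply, Finset.mul_sum, hd t ht]
  exact Finset.sum_congr rfl fun k _ => (mul_assoc _ _ _).symm

theorem IsGalerkinSolution.coeff_zero {N : ℕ} {w₀ : Lp ℂ 2 (volume : Measure ℝ)}
    {wN : ℝ → ℝ → ℂ} (hN : IsGalerkinSolution V ε T q B Q P N w₀ wN)
    (hh : IsHWPParameters T B Q P) {a : ℕ → ℂ} (hT : 0 ≤ T) (ha : wN 0 = hermComb (N + 1) a)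
    {k : ℕ} (hk : k < N + 1) : a k = inner ℂ (hermLp k) w₀ := by
  have h0 : (0 : ℝ) ∈ Icc 0 T := left_mem_Icc.2 hT
  obtain ⟨s, μ, hμ⟩ := exists_coeff_eq_sum_eval hk
  have e : ∀ x, hermComb (N + 1) a x =
      hermComb (N + 1) (fun k => inner ℂ (hermLp k) w₀) x := fun x => by
    rw [← ha, hN.init, hwpProj_eq (hh.P_eq h0) (hh.norm_Q h0), hermComb_apply]
    simp only [inner_hermLp]
  rw [← hμ a, ← hμ (fun k => inner ℂ (hermLp k) w₀)]
  simp only [e]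

/-- The part of the Galerkin error inside the Galerkin space grows at most linearly in time, at a
rate given by the size of the projection error. -/
theorem norm_toLp_coeff_error_le {N : ℕ} {wN : ℝ → ℝ → ℂ} (hN2 : 2 ≤ N) (hT : 0 ≤ T)
    (hh : IsHWPParameters T B Q P) (hw : IsWSolution V ε T q B w)
    (hN : IsGalerkinSolution V ε T q B Q P N (w 0) wN)
    {d : ℝ → ℕ → ℂ} (hd : ∀ s ∈ Icc 0 T, wN s = hermComb (N + 1) (d s)) {K D : ℝ} (hK : 0 ≤ K)
    (hc : ∀ s, Continuous (scaledResidue V ε (q s) (B s)))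
    (hb : ∀ s ∈ Icc 0 T, ∀ x, |scaledResidue V ε (q s) (B s) x| ≤ K * |x| ^ 3)
    (hD : ∀ s ∈ Icc 0 T, ‖hermTail (N + 1) (w s)‖ ≤ D) (ht : t ∈ Icc 0 T) :
    ‖(hermComb (N + 1) (fun k => inner ℂ (hermLp k) (w t) - d t k)).toLp 2
      (volume : Measure ℝ)‖ ≤ K * (√10 * √(((N + 1)! : ℝ) / ((N - 2)! : ℝ))) * D * t := by
  set r : ℝ → ℕ → ℂ := fun s k => inner ℂ (hermLp k) (w s) - d s k
  have hD0 : 0 ≤ D := (norm_nonneg _).trans (hD t ht)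
  have hR : ∀ s, √(∑ k ∈ Finset.range (N + 1), ‖r s k‖ ^ 2) =
      ‖(hermComb (N + 1) (r s)).toLp 2 (volume : Measure ℝ)‖ := fun s => by
    rw [← norm_sq_toLp_hermComb, Real.sqrt_sq (norm_nonneg _)]
  have hr : ∀ s (hs : s ∈ Icc 0 T), ∀ k < N + 1, HasDerivWithinAt (fun s => r s k)
      (-Complex.I * (oscEnergy (B s) k * r s k +
        inner ℂ (potentialMul (hc s) (hb s hs) (herm k)) (hermTail (N + 1) (w s) +
          (hermComb (N + 1) (r s)).toLp 2 (volume : Measure ℝ)))) (Icc 0 T) s := by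
    intro s hs k hk
    refine ((hw.hasDerivWithinAt_inner_hermLp hs (hc s) (hb s hs) k).sub
      (hN.hasDerivWithinAt_coeff hh hd hs (hc s) (hb s hs) hk)).congr_deriv ?_
    rw [← sub_toLp_hermComb_eq, inner_sub_right]
    ring
  rw [← hR]
  refine sqrt_le_mul_of_deriv_le (T := T) (R := fun s => ∑ k ∈ Finset.range (N + 1), ‖r s k‖ ^ 2)
    (R' := fun s => if hs : s ∈ Icc 0 T then ∑ k ∈ Finset.range (N + 1), 2 * inner ℝ (r s k)
      (-Complex.I * (oscEnergy (B s) k * r s k +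
        inner ℂ (potentialMul (hc s) (hb s hs) (herm k)) (hermTail (N + 1) (w s) +
          (hermComb (N + 1) (r s)).toLp 2 (volume : Measure ℝ)))) else 0)
    (fun s => by positivity) ?_ (by positivity) (fun s hs => ?_) (fun s hs => ?_) t ht
  · refine Finset.sum_eq_zero fun k hk => ?_
    have := hN.coeff_zero hh hT (hd 0 (left_mem_Icc.2 hT)) (Finset.mem_range.1 hk)
    simp [r, this]
  · rw [dif_pos hs]
    exact HasDerivWithinAt.fun_sum fun k hk => (hr s hs k (Finset.mem_range.1 hk)).norm_sq
  · rw [dif_pos hs, hR]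
    refine (two_mul_sum_re_le (hc s) (hb s hs) (N + 1) (oscEnergy (B s)) (r s)
      (hermTail (N + 1) (w s))).trans ?_
    have h1 := (norm_potentialMul_le (hc s) (hb s hs) (hermComb (N + 1) (r s))).trans
      (mul_le_mul_of_nonneg_left (norm_toLp_mulX_pow_three_le hN2 (r s)) hK)
    have h2 := mul_le_mul h1 (hD s hs) (norm_nonneg _) (by positivity)
    calc _ ≤ _ := mul_le_mul_of_nonneg_left h2 two_pos.le
      _ = _ := by ring

end

end

theorem mainTheorem2 (V : ℝ → ℝ) (hV : ContDiff ℝ 2 V)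
    (hV3 : ∃ V₃ : ℝ → ℝ, MemLp V₃ ⊤ volume ∧ IsWeakDeriv 3 V V₃)
    (T : ℝ) (hT : 0 < T) (m : ℕ) (Bst : ℝ) :
    ∃ B₁ B₂ : ℝ, ∀ (ε : ℝ), 0 < ε →
      ∀ (q p : ℝ → ℝ) (α : ℝ → ℂ) (B : ℝ → ℝ), IsGWPTParameters V T q p α B →
      ∀ (Q P : ℝ → ℂ), IsHWPParameters T B Q P →
      ∀ (w : ℝ → Lp ℂ 2 (volume : Measure ℝ)), IsWSolution V ε T q B w →
      ∀ (Amw : ℝ → Lp ℂ 2 (volume : Measure ℝ)),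
        (∀ t ∈ Icc 0 T, (lowering (Q t) (P t) ^ m) (Lp.toTemperedDistribution (w t)) =
          Lp.toTemperedDistribution (Amw t)) →
        (∀ t ∈ Icc 0 T, ‖Amw t‖ ≤ Bst * ‖Amw 0‖) →
      ∀ (N : ℕ), 2 ≤ N → m ≤ N + 1 →
      ∀ (wN : ℝ → ℝ → ℂ), IsGalerkinSolution V ε T q B Q P N (w 0) wN →
      ∀ t ∈ Icc 0 T,
        eLpNorm (fun η => w t η - wN t η) 2 volume ≤ ENNReal.ofReal
          (B₁ * √(((N + 1 - m)! : ℝ) / ((N + 1)! : ℝ)) * ‖Amw 0‖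
            + B₂ * T * (√ε / (sInf ((fun s => (α s).im) '' Icc 0 T)) ^ (3 / 2 : ℝ))
              * √(((N + 1 - m)! : ℝ) / ((N - 2)! : ℝ)) * ‖Amw 0‖) := by
  obtain ⟨L, hL0, hL⟩ := exists_lipschitz_iteratedDeriv_two hV hV3
  refine ⟨Bst, √10 * L * Bst, ?_⟩
  intro ε hε q p α B hG Q P hH w hw Amw hA hst N hN2 hmN wN hN t ht
  have hex : ∀ s, ∃ a, s ∈ Icc 0 T → wN s = hermComb (N + 1) a := fun s => by
    by_cases hs : s ∈ Icc 0 T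
    · obtain ⟨a, ha⟩ := exists_hermComb_of_mem_span
        (mem_span_hwp (hH.P_eq hs) (hH.norm_Q hs) (hN.mem_span s hs))
      exact ⟨a, fun _ => ha⟩
    · exact ⟨0, fun h => absurd h hs⟩
  choose d hd using hex
  set A := (sInf ((fun s => (α s).im) '' Icc 0 T)) ^ (3 / 2 : ℝ)
  set D := √(((N + 1 - m)! : ℝ) / ((N + 1)! : ℝ)) * (Bst * ‖Amw 0‖)
  have hinv : ∀ s ∈ Icc 0 T, (B s)⁻¹ ^ 3 ≤ 1 / A := fun s hs => hG.inv_B_pow_three_le hT.le hs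
  have hBpos : ∀ s ∈ Icc 0 T, 0 < B s := fun s hs => (hG.B_pos_and_im_eq hT.le hs).1
  have hA0 : 0 ≤ 1 / A := le_trans (by have := hBpos t ht; positivity) (hinv t ht)
  have hK : 0 ≤ √ε * (L * (1 / A)) := by positivity
  have hc : ∀ s, Continuous (scaledResidue V ε (q s) (B s)) := fun s =>
    (continuous_residuePotential hV _ _ _).const_mul _
  have hb : ∀ s ∈ Icc 0 T, ∀ x, |scaledResidue V ε (q s) (B s) x| ≤
      √ε * (L * (1 / A)) * |x| ^ 3 := fun s hs x => by
    rw [scaledResidue, abs_mul, abs_of_nonneg (Real.sqrt_nonneg ε), mul_assoc]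
    refine mul_le_mul_of_nonneg_left ?_ (Real.sqrt_nonneg ε)
    refine (abs_residuePotential_le hV hL0 hL hε (q s) (hBpos s hs) x).trans ?_
    exact mul_le_mul_of_nonneg_right (mul_le_mul_of_nonneg_left (hinv s hs) hL0) (by positivity)
  have hD : ∀ s ∈ Icc 0 T, ‖hermTail (N + 1) (w s)‖ ≤ D := fun s hs =>
    (norm_hermTail_le (hH.P_eq hs) (hH.norm_Q hs) hmN (w s) (Amw s) (hA s hs)).trans
      (mul_le_mul_of_nonneg_left (hst s hs) (Real.sqrt_nonneg _))
  have hD0 : 0 ≤ D := (norm_nonneg _).trans (hD t ht)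
  have herr := norm_toLp_coeff_error_le hN2 hT.le hH hw hN hd hK hc hb hD ht
  have hnorm : eLpNorm (fun η => w t η - wN t η) 2 volume =
      ENNReal.ofReal ‖w t - (hermComb (N + 1) (d t)).toLp 2 (volume : Measure ℝ)‖ := by
    rw [Lp.norm_def, ENNReal.ofReal_toReal (Lp.eLpNorm_ne_top _)]
    refine eLpNorm_congr_ae ?_
    filter_upwards [Lp.coeFn_sub (w t) ((hermComb (N + 1) (d t)).toLp 2 (volume : Measure ℝ)),
      (hermComb (N + 1) (d t)).coeFn_toLp 2 volume] with x h1 h2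
    rw [h1, Pi.sub_apply, h2, hd t ht]
  rw [hnorm, sub_toLp_hermComb_eq]
  refine ENNReal.ofReal_le_ofReal ((norm_add_le _ _).trans (add_le_add ?_ ?_))
  · exact (hD t ht).trans_eq (by ring)
  · -- The loss from `x³` and the gain from `Aᵐ` combine to the quotient of factorials.
    have hsq : √(((N + 1)! : ℝ) / ((N - 2)! : ℝ)) * √(((N + 1 - m)! : ℝ) / ((N + 1)! : ℝ)) =
        √(((N + 1 - m)! : ℝ) / ((N - 2)! : ℝ)) := by
      rw [← Real.sqrt_mul (by positivity)]
      congr 1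
      field_simp
    refine herr.trans ((mul_le_mul_of_nonneg_left ht.2 (by positivity)).trans_eq ?_)
    rw [← hsq]
    ring
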